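/- Theorem. Let $(M,g_M)$ be a Riemannian manifold with a hyperkähler structure $(I,J,K)$: smooth $g_M$-orthogonal endomorphism fields of $TM$, parallel for the Levi-Civita connection $\nabla$ of $g_M$, with $I^2=J^2=K^2=-\mathrm{id}$ and $IJ=-JI=K$. Let $(N,g_N)$ be a Riemannian manifold and let $F:M\to N$ be a horizontally conformal submersion with dilation $\lambda:M\to(0,\infty)$: $F$ is smooth, every $(F_*)_p$ is surjective, and $g_N(F_*X,F_*Y)=\lambda^2 g_M(X,Y)$ for $X,Y\in(\ker F_*)^\perp$. Assume that $F$ is an almost h-conformal slant submersion with almost h-conformal slant basis $(I,J,K)$ and slant angles $\theta_I,\theta_J,\theta_K$, i.e. for each $R\in\{I,J,K\}$ the angle between $RV$ and $\ker (F_*)_p$ equals $\theta_R$ for all $p\in M$ and all nonzero $V\in\ker (F_*)_p$. Let $\mathcal V,\mathcal H$ be the orthogonal projections onto $\ker F_*$ and $(\ker F_*)^\perp$. For $V\in\Gamma(\ker F_*)$ and $X\in\Gamma((\ker F_*)^\perp)$ write $\phi_RV=\mathcal V RV$, $\omega_RV=\mathcal H RV$, $B_RX=\mathcal V RX$, $C_RX=\mathcal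 H RX$. Let $\mathcal A_XY=\mathcal H\nabla_{\mathcal HX}\mathcal VY+\mathcal V\nabla_{\mathcal HX}\mathcal HY$, and let $\nabla^F$ be the pullback along $F$ of the Levi-Civita connection of $g_N$. For $R\in\{I,J,K\}$ let $(\ast_R)$ be the condition that $$ \begin{aligned} &\lambda^{-2}g_N(\nabla_X^F F_* Y, F_* \omega_R \phi_R V) - \lambda^{-2}g_N(\nabla_X^F F_* C_R Y, F_* \omega_R V) \\ &= g_M(\mathcal{A}_X B_R Y, \omega_R V) \\ &\quad+ g_M(-X(\ln \lambda) C_R Y - C_R Y(\ln \lambda) X + g_M(X, C_R Y)\nabla \ln \lambda,\ \omega_R V) \\ &\quad- g_M(-X(\ln \lambda) Y - Y(\ln \lambda) X + g_M(X, Y)\nabla \ln\lambda,\ \omega_R \phi_R V) \end{aligned} $$ for all $X,Y\in \Gamma((\ker F_*)^{\perp})$ and $V\in \Gamma(\ker F_*)$. If $(\ker F_*)^\perp$ defines a totally geodesic foliation on $M$ (that is, it is involutive and $\nabla_XY\in\Gamma((\ker F_*)^\perp)$ for all $X,Y\in\Gamma((\ker F_*)^\perp)$), then $(\ast_I)$,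 $(\ast_J)$ and $(\ast_K)$ hold. Moreover, for every $R\in\{I,J,K\}$ with $\theta_R\neq 0$, the distribution $(\ker F_*)^\perp$ defines a totally geodesic foliation on $M$ if and only if $(\ast_R)$ holds. In particular, if $\theta_I,\theta_J,\theta_K$ are all nonzero, then these four conditions are equivalent. -/

import Mathlib

open Bundle VectorField
open scoped Manifold ContDiff

namespace SlantSubmersion

noncomputable section Riemannian

variable {E : Type*} [NormedAddCommGroup E] [NormedSpace ℝ E]
  {M : Type*} [TopologicalSpace M] [ChartedSpace E M]

instance instFiniteDimensionalTangentSpace [FiniteDimensional ℝ E] (x : M) :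
    FiniteDimensional ℝ (TangentSpace 𝓘(ℝ, E) x) :=
  inferInstanceAs (FiniteDimensional ℝ E)

/-- A smooth vector field on `M`. -/
def IsSmoothField [IsManifold 𝓘(ℝ, E) ∞ M] (X : Π x : M, TangentSpace 𝓘(ℝ, E) x) : Prop :=
  ContMDiff 𝓘(ℝ, E) 𝓘(ℝ, E).tangent ∞ (fun x => (⟨x, X x⟩ : TangentBundle 𝓘(ℝ, E) M))

/-- A smooth section of the distribution `D`. -/
def IsSmoothSection [IsManifold 𝓘(ℝ, E) ∞ M] (D : Π x : M, Submodule ℝ (TangentSpace 𝓘(ℝ, E) x))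
    (X : Π x : M, TangentSpace 𝓘(ℝ, E) x) : Prop :=
  IsSmoothField X ∧ ∀ x, X x ∈ D x

/-- A smooth section of the endomorphism bundle of the tangent bundle. -/
def IsSmoothEndomorphism [IsManifold 𝓘(ℝ, E) ∞ M]
    (R : Π x : M, TangentSpace 𝓘(ℝ, E) x →L[ℝ] TangentSpace 𝓘(ℝ, E) x) : Prop :=
  ContMDiff 𝓘(ℝ, E) (𝓘(ℝ, E).prod 𝓘(ℝ, E →L[ℝ] E)) ∞
    (fun x => TotalSpace.mk' (E →L[ℝ] E)
      (E := fun x : M => TangentSpace 𝓘(ℝ, E) x →L[ℝ] TangentSpace 𝓘(ℝ, E) x) x (R x))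

variable [RiemannianBundle (fun x : M => TangentSpace 𝓘(ℝ, E) x)]

/-- The right-hand side of the Koszul formula for `2 g(∇_X Y, Z)`:
`X g(Y,Z) + Y g(X,Z) - Z g(X,Y) + g([X,Y],Z) - g([X,Z],Y) - g([Y,Z],X)`. -/
def koszul (X Y Z : Π x : M, TangentSpace 𝓘(ℝ, E) x) (x : M) : ℝ :=
  mvfderiv 𝓘(ℝ, E) (fun y => inner ℝ (Y y) (Z y)) x (X x)
    + mvfderiv 𝓘(ℝ, E) (fun y => inner ℝ (X y) (Z y)) x (Y x)
    - mvfderiv 𝓘(ℝ, E) (fun y => inner ℝ (X y) (Y y)) x (Z x)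
    + inner ℝ (mlieBracket 𝓘(ℝ, E) X Y x) (Z x)
    - inner ℝ (mlieBracket 𝓘(ℝ, E) X Z x) (Y x)
    - inner ℝ (mlieBracket 𝓘(ℝ, E) Y Z x) (X x)

variable [FiniteDimensional ℝ E] [IsManifold 𝓘(ℝ, E) ∞ M]

/-- The Levi-Civita connection of the Riemannian metric of `M`, given by the Koszul formula:
`leviCivita Y x v` is `(∇_v Y)(x)`. Tangent vectors at `x` are extended to local fields by
`FiberBundle.extend`; the Koszul expression at `x` does not depend on the extensions. -/
def leviCivita (Y : Π x : M, TangentSpace 𝓘(ℝ, E) x) (x : M) (v : TangentSpace 𝓘(ℝ, E) x) :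
    TangentSpace 𝓘(ℝ, E) x :=
  let b := stdOrthonormalBasis ℝ (TangentSpace 𝓘(ℝ, E) x)
  ∑ i, ((1 / 2 : ℝ) * koszul (FiberBundle.extend E v) Y (FiberBundle.extend E (b i)) x) • b i

/-- The gradient vector field of a function. -/
def gradient (f : M → ℝ) (x : M) : TangentSpace 𝓘(ℝ, E) x :=
  (InnerProductSpace.toDual ℝ (TangentSpace 𝓘(ℝ, E) x)).symm (mvfderiv 𝓘(ℝ, E) f x)

/-- The distribution `D` defines a totally geodesic foliation: it is involutive (hence tangent to a
foliation) and the second fundamental form of its leaves, which is the component of `∇_X Y` normal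
to `D` for sections `X`, `Y` of `D`, vanishes. -/
structure DefinesTotallyGeodesicFoliation
    (D : Π x : M, Submodule ℝ (TangentSpace 𝓘(ℝ, E) x)) : Prop where
  involutive : ∀ X Y : Π x : M, TangentSpace 𝓘(ℝ, E) x,
    IsSmoothSection D X → IsSmoothSection D Y → ∀ x, mlieBracket 𝓘(ℝ, E) X Y x ∈ D x
  secondFundamentalForm_eq_zero : ∀ X Y : Π x : M, TangentSpace 𝓘(ℝ, E) x,
    IsSmoothSection D X → IsSmoothSection D Y →
      ∀ x, (D x)ᗮ.starProjection (leviCivita Y x (X x)) = 0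

/-- `R` is a smooth orthogonal almost complex structure on the Riemannian manifold `M` that is
parallel for the Levi-Civita connection, `∇R = 0`. -/
structure IsParallelHermitianStructure
    (R : Π x : M, TangentSpace 𝓘(ℝ, E) x →L[ℝ] TangentSpace 𝓘(ℝ, E) x) : Prop where
  smooth : IsSmoothEndomorphism R
  sq : ∀ x v, R x (R x v) = -v
  isometry : ∀ x (v w : TangentSpace 𝓘(ℝ, E) x), inner ℝ (R x v) (R x w) = inner ℝ v w
  parallel : ∀ Y : Π x : M, TangentSpace 𝓘(ℝ, E) x, IsSmoothField Y →
    ∀ x v, leviCivita (fun y => R y (Y y)) x v = R x (leviCivita Y x v)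

/-- `(I, J, K)` is a hyperkähler structure on the Riemannian manifold `M`: a global quaternionic
Hermitian basis that is parallel for the Levi-Civita connection. -/
structure IsHyperkahlerStructure
    (I J K : Π x : M, TangentSpace 𝓘(ℝ, E) x →L[ℝ] TangentSpace 𝓘(ℝ, E) x) : Prop where
  kahler_I : IsParallelHermitianStructure I
  kahler_J : IsParallelHermitianStructure J
  kahler_K : IsParallelHermitianStructure K
  I_mul_J : ∀ x v, I x (J x v) = K x v
  J_mul_I : ∀ x v, J x (I x v) = -K x v

end Riemannian

noncomputable section Maps

/-- The angle between a vector and a subspace of an inner product space, that is, the angle between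
the vector and its orthogonal projection to the subspace (`π / 2` if that projection is zero). -/
def angleToSubspace {W : Type*} [NormedAddCommGroup W] [InnerProductSpace ℝ W]
    (v : W) (U : Submodule ℝ W) [U.HasOrthogonalProjection] : ℝ :=
  InnerProductGeometry.angle v (U.starProjection v)

variable (E : Type*) [NormedAddCommGroup E] [NormedSpace ℝ E]
  {M : Type*} [TopologicalSpace M] [ChartedSpace E M]
  (E' : Type*) [NormedAddCommGroup E'] [NormedSpace ℝ E']
  {N : Type*} [TopologicalSpace N] [ChartedSpace E' N]

/-- The differential `F_*` at `x`. -/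
def dmap (F : M → N) (x : M) : TangentSpace 𝓘(ℝ, E) x →L[ℝ] TangentSpace 𝓘(ℝ, E') (F x) :=
  mfderiv 𝓘(ℝ, E) 𝓘(ℝ, E') F x

/-- The vertical distribution `ker F_*`. -/
def vert (F : M → N) (x : M) : Submodule ℝ (TangentSpace 𝓘(ℝ, E) x) :=
  (dmap E E' F x).ker

variable [RiemannianBundle (fun x : M => TangentSpace 𝓘(ℝ, E) x)]

/-- The horizontal distribution `(ker F_*)^⊥`. -/
def horiz (F : M → N) (x : M) : Submodule ℝ (TangentSpace 𝓘(ℝ, E) x) :=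
  (vert E E' F x)ᗮ

variable [FiniteDimensional ℝ E]

/-- The projection of a vector field to the vertical distribution. -/
def projV (F : M → N) (X : Π x : M, TangentSpace 𝓘(ℝ, E) x) (x : M) : TangentSpace 𝓘(ℝ, E) x :=
  (vert E E' F x).starProjection (X x)

/-- The projection of a vector field to the horizontal distribution. -/
def projH (F : M → N) (X : Π x : M, TangentSpace 𝓘(ℝ, E) x) (x : M) : TangentSpace 𝓘(ℝ, E) x :=
  (horiz E E' F x).starProjection (X x)

/-- `φ_R V`, the vertical part of `R V`, for `V` vertical. -/
def phi (F : M → N) (R : Π x : M, TangentSpace 𝓘(ℝ, E) x →L[ℝ] TangentSpace 𝓘(ℝ, E) x)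
    (V : Π x : M, TangentSpace 𝓘(ℝ, E) x) : Π x : M, TangentSpace 𝓘(ℝ, E) x :=
  projV E E' F (fun x => R x (V x))

/-- `ω_R V`, the horizontal part of `R V`, for `V` vertical. -/
def omega (F : M → N) (R : Π x : M, TangentSpace 𝓘(ℝ, E) x →L[ℝ] TangentSpace 𝓘(ℝ, E) x)
    (V : Π x : M, TangentSpace 𝓘(ℝ, E) x) : Π x : M, TangentSpace 𝓘(ℝ, E) x :=
  projH E E' F (fun x => R x (V x))

/-- `B_R X`, the vertical part of `R X`, for `X` horizontal. -/
def opB (F : M → N) (R : Π x : M, TangentSpace 𝓘(ℝ, E) x →L[ℝ] TangentSpace 𝓘(ℝ, E) x)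
    (X : Π x : M, TangentSpace 𝓘(ℝ, E) x) : Π x : M, TangentSpace 𝓘(ℝ, E) x :=
  projV E E' F (fun x => R x (X x))

/-- `C_R X`, the horizontal part of `R X`, for `X` horizontal. -/
def opC (F : M → N) (R : Π x : M, TangentSpace 𝓘(ℝ, E) x →L[ℝ] TangentSpace 𝓘(ℝ, E) x)
    (X : Π x : M, TangentSpace 𝓘(ℝ, E) x) : Π x : M, TangentSpace 𝓘(ℝ, E) x :=
  projH E E' F (fun x => R x (X x))

/-- For every point `x` and every nonzero `v` in `ker F_*` at `x`, the angle between `R v` and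
`ker F_*` is `θ`. -/
def IsSlantAngle (F : M → N) (R : Π x : M, TangentSpace 𝓘(ℝ, E) x →L[ℝ] TangentSpace 𝓘(ℝ, E) x)
    (θ : ℝ) : Prop :=
  ∀ x, ∀ v ∈ vert E E' F x, v ≠ 0 → angleToSubspace (R x v) (vert E E' F x) = θ

variable [IsManifold 𝓘(ℝ, E) ∞ M]

/-- O'Neill's tensor `A_X Y = ℋ ∇_{ℋX} 𝒱Y + 𝒱 ∇_{ℋX} ℋY`. -/
def oneillA (F : M → N) (X Y : Π x : M, TangentSpace 𝓘(ℝ, E) x) : Π x : M, TangentSpace 𝓘(ℝ, E) x :=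
  projH E E' F (fun x => leviCivita (projV E E' F Y) x (projH E E' F X x))
    + projV E E' F (fun x => leviCivita (projH E E' F Y) x (projH E E' F X x))

variable [FiniteDimensional ℝ E'] [IsManifold 𝓘(ℝ, E') ∞ N]
  [RiemannianBundle (fun y : N => TangentSpace 𝓘(ℝ, E') y)]

/-- `F` is a horizontally conformal submersion with dilation `lam`. -/
structure IsHorizontallyConformalSubmersion (F : M → N) (lam : M → ℝ) : Prop where
  smooth : ContMDiff 𝓘(ℝ, E) 𝓘(ℝ, E') ∞ F
  surjective_dmap : ∀ x, Function.Surjective (dmap E E' F x)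
  dilation_pos : ∀ x, 0 < lam x
  conformal : ∀ x, ∀ u ∈ horiz E E' F x, ∀ v ∈ horiz E E' F x,
    inner ℝ (dmap E E' F x u) (dmap E E' F x v) = lam x ^ 2 * inner ℝ u v

/-- `F` is an almost h-conformal slant submersion with dilation `lam` for which the global
quaternionic Hermitian basis `(I, J, K)` is an almost h-conformal slant basis with slant angles
`θI`, `θJ`, `θK`. -/
structure IsAlmostHConformalSlantSubmersion (F : M → N) (lam : M → ℝ)
    (I J K : Π x : M, TangentSpace 𝓘(ℝ, E) x →L[ℝ] TangentSpace 𝓘(ℝ, E) x)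
    (θI θJ θK : ℝ) : Prop where
  conformalSubmersion : IsHorizontallyConformalSubmersion E E' F lam
  slant_I : IsSlantAngle E E' F I θI
  slant_J : IsSlantAngle E E' F J θJ
  slant_K : IsSlantAngle E E' F K θK

/-- The pullback along `F` of the Levi-Civita connection of `N`: for a section `W` of `F^* TN`,
`pullbackConnection E E' F W x v` is `(∇^F_v W)(x)`. In the trivialization `t` of `TN` around `F x`
one has `W = ∑ wʲ (s_j ∘ F)` for the frame `s_j` of constant coordinates, and
`∇^F_v W = ∑ dwʲ(v) s_j(F x) + ∑ wʲ(x) (∇_{F_* v} s_j)(F x)`. The first sum is the derivative of the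
coordinates of `W`; the second is the covariant derivative along `F_* v` of the field with the
constant coordinates of `W x`, which is `FiberBundle.extend E' (W x)`. -/
def pullbackConnection (F : M → N) (W : Π x : M, TangentSpace 𝓘(ℝ, E') (F x)) (x : M)
    (v : TangentSpace 𝓘(ℝ, E) x) : TangentSpace 𝓘(ℝ, E') (F x) :=
  let t := trivializationAt E' (TangentSpace 𝓘(ℝ, E') : N → Type _) (F x)
  t.symmL ℝ (F x) (mvfderiv 𝓘(ℝ, E)
      (fun y => (t (⟨F y, W y⟩ : TangentBundle 𝓘(ℝ, E') N)).2) x v)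
    + leviCivita (FiberBundle.extend E' (W x)) (F x) (dmap E E' F x v)

/-- The identity
`λ⁻² g_N(∇^F_X F_* Y, F_* ω_R φ_R V) - λ⁻² g_N(∇^F_X F_* C_R Y, F_* ω_R V)`
`= g_M(A_X B_R Y, ω_R V)`
`+ g_M(-X(ln λ) C_R Y - (C_R Y)(ln λ) X + g_M(X, C_R Y) ∇ ln λ, ω_R V)`
`- g_M(-X(ln λ) Y - Y(ln λ) X + g_M(X, Y) ∇ ln λ, ω_R φ_R V)`
for all smooth horizontal fields `X`, `Y` and all smooth vertical fields `V`. -/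
def SlantIdentity (F : M → N) (lam : M → ℝ)
    (R : Π x : M, TangentSpace 𝓘(ℝ, E) x →L[ℝ] TangentSpace 𝓘(ℝ, E) x) : Prop :=
  let ph := phi E E' F R
  let om := omega E E' F R
  let B := opB E E' F R
  let C := opC E E' F R
  let lnLam : M → ℝ := fun y => Real.log (lam y)
  let dln := mvfderiv 𝓘(ℝ, E) lnLam
  ∀ X Y V : Π x : M, TangentSpace 𝓘(ℝ, E) x,
    IsSmoothSection (horiz E E' F) X → IsSmoothSection (horiz E E' F) Y →
    IsSmoothSection (vert E E' F) V → ∀ x : M,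
      (lam x ^ 2)⁻¹ * inner ℝ
          (pullbackConnection E E' F (fun y => dmap E E' F y (Y y)) x (X x))
          (dmap E E' F x (om (ph V) x))
        - (lam x ^ 2)⁻¹ * inner ℝ
          (pullbackConnection E E' F (fun y => dmap E E' F y (C Y y)) x (X x))
          (dmap E E' F x (om V x))
      = inner ℝ (oneillA E E' F X (B Y) x) (om V x)
        + inner ℝ (-(dln x (X x)) • C Y x - dln x (C Y x) • X x
            + (inner ℝ (X x) (C Y x) : ℝ) • gradient lnLam x) (om V x)
        - inner ℝ (-(dln x (X x)) • Y x - dln x (Y x) • X x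
            + (inner ℝ (X x) (Y x) : ℝ) • gradient lnLam x) (om (ph V) x)

end Maps

end SlantSubmersion

open SlantSubmersion

/-! Take `X`, `Y` horizontal, `V` vertical, and put n = ∇_X Y. As R is orthogonal and parallel, g(n,
V) = g(Rn, RV) with Rn = ∇_X(BY) + ∇_X(CY) and RV = φV + ωV. Skewness gives g(Rn, φV) = -g(n, RφV),
and the constant slant angle forces φφV = -cos²θ V (`inner_compression_compression`). Hence (1 -
cos²θ) g(n, V) = g(A_X BY, ωV) + g(∇_X CY, ωV) - g(n, ωφV).

The last two terms pair derivatives of horizontal fields with horizontal vectors. For these,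
`inner_pullbackConnection_dmap` gives λ⁻² g_N(∇^F_X F_*Y, F_*Z) = g(∇_X Y, Z) + X(ln λ) g(Y, Z) +
Y(ln λ) g(X, Z) - Z(ln λ) g(X, Y), proved by comparing the Koszul formulas of fields on N and of
their horizontal lifts. After substitution, (∗_R) says exactly that (1 - cos²θ) g(∇_X Y, V) = 0
(`slantIdentity_iff`).

The foliation is totally geodesic exactly when all g(∇_X Y, V) vanish, involutivity being a
consequence of zero torsion. When θ ≠ 0, the factor 1 - cos²θ is nonzero as soon as some nonzero
vertical vector exists. -/

set_option linter.unusedSectionVars false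

namespace SlantSubmersion

/-! ### Linear algebra of conformal surjections and of slant subspaces. -/

section LinearAlgebra

variable {V W : Type*} [NormedAddCommGroup V] [InnerProductSpace ℝ V] [FiniteDimensional ℝ V]
  [NormedAddCommGroup W] [InnerProductSpace ℝ W] [FiniteDimensional ℝ W]

theorem adjoint_mem_ker_orthogonal (A : V →ₗ[ℝ] W) (w : W) :
    LinearMap.adjoint A w ∈ A.kerᗮ := by
  rw [Submodule.mem_orthogonal]
  intro u hu
  rw [LinearMap.adjoint_inner_right, LinearMap.mem_ker.mp hu, inner_zero_left]

theorem map_starProjection_ker_orthogonal {V W : Type*} [NormedAddCommGroup V]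
    [InnerProductSpace ℝ V] [FiniteDimensional ℝ V] [NormedAddCommGroup W] [InnerProductSpace ℝ W]
    (A : V →ₗ[ℝ] W) (v : V) :
    A (A.kerᗮ.starProjection v) = A v := by
  have h : v - A.kerᗮ.starProjection v ∈ A.ker := by
    have := Submodule.sub_starProjection_mem_orthogonal (K := A.kerᗮ) v
    rwa [Submodule.orthogonal_orthogonal] at this
  have := LinearMap.mem_ker.mp h
  rw [map_sub, sub_eq_zero] at this
  exact this.symm

/-- A surjective linear map that is conformal with factor `c` on the orthogonal complement of its
kernel satisfies `A A* = c`. -/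
theorem apply_adjoint_of_conformal (A : V →ₗ[ℝ] W) (hA : Function.Surjective A) {c : ℝ}
    (hc : ∀ u ∈ A.kerᗮ, ∀ v ∈ A.kerᗮ, inner ℝ (A u) (A v) = c * inner ℝ u v) (w : W) :
    A (LinearMap.adjoint A w) = c • w := by
  refine ext_inner_left ℝ fun z => ?_
  obtain ⟨v, rfl⟩ := hA z
  rw [← map_starProjection_ker_orthogonal A v,
    hc _ (Submodule.starProjection_apply_mem _ _) _ (adjoint_mem_ker_orthogonal A w),
    LinearMap.adjoint_inner_right, inner_smul_right]

/-- Since A A* = c, the vector c⁻¹ A* A v has the same image as v, and it lies in the range of A*,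
orthogonal to the kernel. This frame-free formula is what later makes the horizontal projection
visibly smooth. -/
theorem starProjection_ker_orthogonal_of_conformal (A : V →ₗ[ℝ] W) (hA : Function.Surjective A)
    {c : ℝ} (hc0 : c ≠ 0)
    (hc : ∀ u ∈ A.kerᗮ, ∀ v ∈ A.kerᗮ, inner ℝ (A u) (A v) = c * inner ℝ u v) (v : V) :
    A.kerᗮ.starProjection v = c⁻¹ • LinearMap.adjoint A (A v) := by
  apply Submodule.eq_starProjection_of_mem_of_inner_eq_zero
  · exact Submodule.smul_mem _ _ (adjoint_mem_ker_orthogonal A _)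
  · intro w hw
    have : v - c⁻¹ • LinearMap.adjoint A (A v) ∈ A.ker := by
      rw [LinearMap.mem_ker, map_sub, map_smul, apply_adjoint_of_conformal A hA hc, smul_smul,
        inv_mul_cancel₀ hc0, one_smul, sub_self]
    exact (Submodule.mem_orthogonal _ _).mp hw _ this

/-- The cosine of the angle between a vector and a subspace. -/
theorem norm_starProjection_eq_cos_angleToSubspace (v : V) (U : Submodule ℝ V) :
    ‖U.starProjection v‖ = Real.cos (angleToSubspace v U) * ‖v‖ := by
  by_cases h : U.starProjection v = 0
  · simp [angleToSubspace, h]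
  have h1 : inner ℝ v (U.starProjection v) = ‖U.starProjection v‖ ^ 2 := by
    rw [← real_inner_self_eq_norm_sq, ← sub_eq_zero, ← inner_sub_left]
    exact Submodule.starProjection_inner_eq_zero v _ (Submodule.starProjection_apply_mem _ _)
  have h2 := InnerProductGeometry.cos_angle_mul_norm_mul_norm v (U.starProjection v)
  rw [h1, ← mul_assoc, sq] at h2
  exact (mul_right_cancel₀ (norm_ne_zero_iff.mpr h) h2).symm

/-- If `R` is an orthogonal complex structure making a constant angle with `U` on `U`, then the
square of its compression to `U` is `-cos² θ`. -/
theorem inner_compression_compression (R : V →L[ℝ] V) (hsq : ∀ v, R (R v) = -v)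
    (hiso : ∀ v w, inner ℝ (R v) (R w) = inner ℝ v w) (U : Submodule ℝ V) {θ : ℝ}
    (hθ : ∀ v ∈ U, v ≠ 0 → angleToSubspace (R v) U = θ) {v : V} (hv : v ∈ U) :
    U.starProjection (R (U.starProjection (R v))) = -(Real.cos θ ^ 2) • v := by
  have hskew : ∀ a b : V, inner ℝ (R a) b = -inner ℝ a (R b) := fun a b => by
    have := hiso a (R b)
    rw [hsq, inner_neg_right] at this
    linarith
  -- With P the projection to U, the slant condition reads |PRu|² = cos²θ |u|² on U, and `hpol` is
  -- its polarization. As PR is skew on U, (PR)² = -(PR)*(PR).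
  have hn : ∀ u ∈ U, inner ℝ (U.starProjection (R u)) (U.starProjection (R u))
      = Real.cos θ ^ 2 * inner ℝ u u := by
    intro u hu
    rw [real_inner_self_eq_norm_sq, real_inner_self_eq_norm_sq]
    by_cases h0 : u = 0
    · simp [h0]
    rw [norm_starProjection_eq_cos_angleToSubspace, hθ u hu h0, mul_pow,
      ← real_inner_self_eq_norm_sq (R u), hiso, real_inner_self_eq_norm_sq]
  have hpol : ∀ u ∈ U, ∀ w ∈ U, inner ℝ (U.starProjection (R u)) (U.starProjection (R w))
      = Real.cos θ ^ 2 * inner ℝ u w := by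
    intro u hu w hw
    have h1 := hn (u + w) (U.add_mem hu hw)
    have h2 := hn u hu
    have h3 := hn w hw
    simp only [map_add, inner_add_left, inner_add_right] at h1
    have h4 := real_inner_comm (U.starProjection (R u)) (U.starProjection (R w))
    have h5 := real_inner_comm u w
    rw [h4, h5] at h1
    linarith
  have hmem : ∀ a, U.starProjection a ∈ U := fun a => Submodule.starProjection_apply_mem _ _
  have hsa : ∀ a, ∀ w ∈ U, inner ℝ (U.starProjection a) w = inner ℝ a w := fun a w hw => by
    have := Submodule.starProjection_inner_eq_zero a w hw
    rw [inner_sub_left] at this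
    linarith
  have key : ∀ w ∈ U, inner ℝ (U.starProjection (R (U.starProjection (R v)))
      - -(Real.cos θ ^ 2) • v) w = 0 := by
    intro w hw
    rw [inner_sub_left, hsa _ w hw, hskew, real_inner_comm, ← hsa _ _ (hmem _), real_inner_comm,
      hpol v hv w hw, inner_smul_left]
    simp
  have := key (U.starProjection (R (U.starProjection (R v))) - -(Real.cos θ ^ 2) • v)
    (U.sub_mem (hmem _) (U.smul_mem _ hv))
  rwa [inner_self_eq_zero, sub_eq_zero] at this

/-- A nonzero vector makes an angle of non-negative cosine with its own projection. This rules out θ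
= π, so that cos²θ = 1 leaves only θ = 0 in [0, π]. -/
theorem cos_sq_ne_one_of_angle_eq (v : V) (hv : v ≠ 0) (U : Submodule ℝ V) {θ : ℝ}
    (h : angleToSubspace v U = θ) (hθ : θ ≠ 0) : Real.cos θ ^ 2 ≠ 1 := by
  intro hc
  have h0 : 0 ≤ Real.cos θ := by
    have := norm_starProjection_eq_cos_angleToSubspace v U
    rw [h] at this
    exact nonneg_of_mul_nonneg_left (this ▸ norm_nonneg _) (norm_pos_iff.mpr hv)
  have h1 : Real.cos θ = 1 := by nlinarith
  have hmem : θ ∈ Set.Icc 0 Real.pi := by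
    rw [← h]
    exact ⟨InnerProductGeometry.angle_nonneg _ _, InnerProductGeometry.angle_le_pi _ _⟩
  exact hθ (Real.injOn_cos hmem ⟨le_rfl, Real.pi_pos.le⟩ (by rw [h1, Real.cos_zero]))

end LinearAlgebra

/-! ### The Koszul expression and the basic properties of the Levi-Civita connection. -/

section Koszul

open Filter Topology

variable {E : Type*} [NormedAddCommGroup E] [NormedSpace ℝ E] [FiniteDimensional ℝ E]
  {M : Type*} [TopologicalSpace M] [ChartedSpace E M] [IsManifold 𝓘(ℝ, E) ∞ M]

/-- A vector field is differentiable at a point. -/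
abbrev FieldMDiffAt (X : Π x : M, TangentSpace 𝓘(ℝ, E) x) (x : M) : Prop :=
  MDifferentiableAt 𝓘(ℝ, E) 𝓘(ℝ, E).tangent
    (fun y => (⟨y, X y⟩ : TangentBundle 𝓘(ℝ, E) M)) x

/-- A vector field is smooth at a point. -/
abbrev FieldSmoothAt (X : Π x : M, TangentSpace 𝓘(ℝ, E) x) (x : M) : Prop :=
  ContMDiffAt 𝓘(ℝ, E) 𝓘(ℝ, E).tangent ∞
    (fun y => (⟨y, X y⟩ : TangentBundle 𝓘(ℝ, E) M)) x

theorem FieldSmoothAt.mdiffAt {X : Π x : M, TangentSpace 𝓘(ℝ, E) x} {x : M}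
    (h : FieldSmoothAt X x) : FieldMDiffAt X x :=
  ContMDiffAt.mdifferentiableAt h (by simp)

theorem mvfderiv_congr {x : M} {G : Type*} [NormedAddCommGroup G] [NormedSpace ℝ G] {f g : M → G}
    (h : f =ᶠ[𝓝 x] g) : mvfderiv 𝓘(ℝ, E) f x = mvfderiv 𝓘(ℝ, E) g x := by
  ext v
  exact DFunLike.congr_fun (h.mfderiv_eq (I := 𝓘(ℝ, E)) (I' := 𝓘(ℝ, G))) v

variable [RiemannianBundle (fun x : M => TangentSpace 𝓘(ℝ, E) x)]
  [IsContMDiffRiemannianBundle 𝓘(ℝ, E) ∞ E (fun x : M => TangentSpace 𝓘(ℝ, E) x)]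

variable {X Y Y' Z : Π x : M, TangentSpace 𝓘(ℝ, E) x} {x : M}

theorem FieldMDiffAt.inner (hX : FieldMDiffAt X x) (hY : FieldMDiffAt Y x) :
    MDifferentiableAt 𝓘(ℝ, E) 𝓘(ℝ, ℝ) (fun y => inner ℝ (X y) (Y y)) x :=
  MDifferentiableAt.inner_bundle (F := E) hX hY

theorem koszul_congr (h : Y =ᶠ[𝓝 x] Y') : koszul X Y Z x = koszul X Y' Z x := by
  have h1 : (fun y => inner ℝ (Y y) (Z y)) =ᶠ[𝓝 x] (fun y => inner ℝ (Y' y) (Z y)) := by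
    filter_upwards [h] with y hy using by rw [hy]
  have h2 : (fun y => inner ℝ (X y) (Y y)) =ᶠ[𝓝 x] (fun y => inner ℝ (X y) (Y' y)) := by
    filter_upwards [h] with y hy using by rw [hy]
  simp only [koszul]
  rw [mvfderiv_congr h1, mvfderiv_congr h2, h.mlieBracket_vectorField_eq (EventuallyEq.refl _ Z),
    (EventuallyEq.refl _ X).mlieBracket_vectorField_eq h, h.self_of_nhds]

/-- Every term except the one with [X, Y] is symmetric in `X` and `Y`; this is the source of zero
torsion. -/
theorem koszul_sub_koszul_swap :
    koszul X Y Z x - koszul Y X Z x = 2 * inner ℝ (mlieBracket 𝓘(ℝ, E) X Y x) (Z x) := by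
  have h : (fun y => inner ℝ (Y y) (X y)) = fun y => inner ℝ (X y) (Y y) := by
    funext y; exact real_inner_comm _ _
  simp only [koszul, h]
  rw [mlieBracket_swap_apply (V := Y) (W := X), inner_neg_left]
  ring

/-- The derivatives of a coefficient of `X` coming from the metric terms cancel those coming from
the brackets. Tensoriality in the two outer slots makes the extensions chosen in `leviCivita`
irrelevant. -/
theorem tensorialAt_koszul_left (hY : FieldMDiffAt Y x) (hZ : FieldMDiffAt Z x) :
    TensorialAt 𝓘(ℝ, E) E (fun X => koszul X Y Z x) x where
  smul {f X} hf hX := by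
    have h1 := mvfderiv_fun_mul hf (FieldMDiffAt.inner hX hZ)
    have h2 := mvfderiv_fun_mul hf (FieldMDiffAt.inner hX hY)
    simp only [koszul, Pi.smul_apply', real_inner_smul_left, real_inner_smul_right, map_smul,
      mlieBracket_smul_left hf hX, h1, h2, inner_add_left]
    simp
    ring
  add {X X'} hX hX' := by
    have h1 := mvfderiv_fun_add (FieldMDiffAt.inner hX hZ) (FieldMDiffAt.inner hX' hZ)
    have h2 := mvfderiv_fun_add (FieldMDiffAt.inner hX hY) (FieldMDiffAt.inner hX' hY)
    simp only [koszul, Pi.add_apply, inner_add_left, inner_add_right, map_add,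
      mlieBracket_add_left hX hX', h1, h2]
    simp
    ring

theorem tensorialAt_koszul_right (hX : FieldMDiffAt X x) (hY : FieldMDiffAt Y x) :
    TensorialAt 𝓘(ℝ, E) E (fun Z => koszul X Y Z x) x where
  smul {f Z} hf hZ := by
    have h1 := mvfderiv_fun_mul hf (FieldMDiffAt.inner hX hZ)
    have h2 := mvfderiv_fun_mul hf (FieldMDiffAt.inner hY hZ)
    simp only [koszul, Pi.smul_apply', real_inner_smul_left, real_inner_smul_right, map_smul,
      mlieBracket_smul_right hf hZ, h1, h2, inner_add_left]
    simp [real_inner_comm]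
    ring
  add {Z Z'} hZ hZ' := by
    have h1 := mvfderiv_fun_add (FieldMDiffAt.inner hX hZ) (FieldMDiffAt.inner hX hZ')
    have h2 := mvfderiv_fun_add (FieldMDiffAt.inner hY hZ) (FieldMDiffAt.inner hY hZ')
    simp only [koszul, Pi.add_apply, inner_add_left, inner_add_right, map_add,
      mlieBracket_add_right hZ hZ', h1, h2]
    simp
    ring

/-- In the slot of the differentiated field the terms in X f add up instead of cancelling; after the
factor 1/2 this is the Leibniz rule. -/
theorem koszul_smul_middle {f : M → ℝ} (hf : MDifferentiableAt 𝓘(ℝ, E) 𝓘(ℝ, ℝ) f x)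
    (hX : FieldMDiffAt X x) (hY : FieldMDiffAt Y x) (hZ : FieldMDiffAt Z x) :
    koszul X (f • Y) Z x
      = f x * koszul X Y Z x + 2 * mvfderiv 𝓘(ℝ, E) f x (X x) * inner ℝ (Y x) (Z x) := by
  have h1 := mvfderiv_fun_mul hf (FieldMDiffAt.inner hX hY)
  have h2 := mvfderiv_fun_mul hf (FieldMDiffAt.inner hY hZ)
  simp only [koszul, Pi.smul_apply', real_inner_smul_left, real_inner_smul_right, map_smul,
    mlieBracket_smul_right hf hY, mlieBracket_smul_left hf hY, h1, h2, inner_add_left]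
  simp [real_inner_comm]
  ring

theorem koszul_add_middle (hX : FieldMDiffAt X x) (hY : FieldMDiffAt Y x)
    (hY' : FieldMDiffAt Y' x) (hZ : FieldMDiffAt Z x) :
    koszul X (Y + Y') Z x = koszul X Y Z x + koszul X Y' Z x := by
  have h1 := mvfderiv_fun_add (FieldMDiffAt.inner hX hY) (FieldMDiffAt.inner hX hY')
  have h2 := mvfderiv_fun_add (FieldMDiffAt.inner hY hZ) (FieldMDiffAt.inner hY' hZ)
  simp only [koszul, Pi.add_apply, inner_add_left, inner_add_right, map_add,
    mlieBracket_add_right hY hY', mlieBracket_add_left hY hY', h1, h2]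
  simp
  ring

theorem koszul_zero_middle : koszul X (0 : Π x : M, TangentSpace 𝓘(ℝ, E) x) Z x = 0 := by
  have h0 : mvfderiv 𝓘(ℝ, E) (fun _ : M => (0 : ℝ)) x = 0 := mvfderiv_const _
  simp [koszul, h0]

theorem koszul_sum_smul_middle {ι : Type*} (s : Finset ι) {f : ι → M → ℝ}
    {S : ι → Π x : M, TangentSpace 𝓘(ℝ, E) x}
    (hf : ∀ i, MDifferentiableAt 𝓘(ℝ, E) 𝓘(ℝ, ℝ) (f i) x) (hS : ∀ i, FieldMDiffAt (S i) x)
    (hX : FieldMDiffAt X x) (hZ : FieldMDiffAt Z x) :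
    koszul X (fun y => ∑ i ∈ s, f i y • S i y) Z x
      = ∑ i ∈ s, (f i x * koszul X (S i) Z x
          + 2 * mvfderiv 𝓘(ℝ, E) (f i) x (X x) * inner ℝ (S i x) (Z x)) := by
  classical
  induction s using Finset.induction_on with
  | empty => exact koszul_zero_middle
  | insert a s ha ih =>
    simp only [Finset.sum_insert ha]
    have h1 : FieldMDiffAt (f a • S a) x := (hf a).smul_section (hS a)
    have h2 : FieldMDiffAt (fun y => ∑ i ∈ s, f i y • S i y) x :=
      MDifferentiableAt.sum_section fun i _ => (hf i).smul_section (hS i)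
    rw [← ih, ← koszul_smul_middle (hf a) hX (hS a) hZ, ← koszul_add_middle hX h1 h2 hZ]
    rfl

theorem inner_leviCivita (hX : FieldMDiffAt X x) (hY : FieldMDiffAt Y x) (hZ : FieldMDiffAt Z x) :
    inner ℝ (leviCivita Y x (X x)) (Z x) = (1 / 2 : ℝ) * koszul X Y Z x := by
  have hext : ∀ v : TangentSpace 𝓘(ℝ, E) x, FieldMDiffAt (FiberBundle.extend E v) x :=
    fun v => FiberBundle.mdifferentiableAt_extend 𝓘(ℝ, E) E v
  set L := TensorialAt.mkHom _ x (tensorialAt_koszul_right (hext (X x)) hY) with hL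
  have hLv : ∀ v, L v = koszul (FiberBundle.extend E (X x)) Y (FiberBundle.extend E v) x :=
    fun v => rfl
  have hLZ : L (Z x) = koszul X Y Z x := by
    rw [hL, TensorialAt.mkHom_apply _ hZ]
    exact (tensorialAt_koszul_left hY hZ).pointwise (hext _) hX (by simp)
  rw [← hLZ]
  conv_rhs => rw [← (stdOrthonormalBasis ℝ (TangentSpace 𝓘(ℝ, E) x)).sum_repr' (Z x)]
  simp only [leviCivita, ← hLv, sum_inner, map_sum, map_smul, inner_smul_left, Finset.mul_sum]
  refine Finset.sum_congr rfl fun i _ => ?_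
  simp
  ring

theorem leviCivita_add (hY : FieldMDiffAt Y x) (hY' : FieldMDiffAt Y' x)
    (v : TangentSpace 𝓘(ℝ, E) x) :
    leviCivita (Y + Y') x v = leviCivita Y x v + leviCivita Y' x v := by
  have hext : ∀ v : TangentSpace 𝓘(ℝ, E) x, FieldMDiffAt (FiberBundle.extend E v) x :=
    fun v => FiberBundle.mdifferentiableAt_extend 𝓘(ℝ, E) E v
  simp only [leviCivita, koszul_add_middle (hext _) hY hY' (hext _), mul_add, add_smul,
    Finset.sum_add_distrib]

/-- The Levi-Civita connection is torsion free. -/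
theorem leviCivita_sub_leviCivita_swap (hX : FieldMDiffAt X x) (hY : FieldMDiffAt Y x) :
    leviCivita Y x (X x) - leviCivita X x (Y x) = mlieBracket 𝓘(ℝ, E) X Y x := by
  refine ext_inner_right ℝ fun w => ?_
  have hw : FieldMDiffAt (FiberBundle.extend E w) x :=
    FiberBundle.mdifferentiableAt_extend 𝓘(ℝ, E) E w
  have h1 := inner_leviCivita hX hY hw
  have h2 := inner_leviCivita hY hX hw
  have h3 := koszul_sub_koszul_swap (X := X) (Y := Y) (Z := FiberBundle.extend E w) (x := x)
  rw [FiberBundle.extend_apply_self] at h1 h2 h3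
  rw [inner_sub_left, h1, h2]
  linarith

end Koszul

/-! ### Smoothness of the dilation and of the horizontal and vertical projections. -/

section Smoothness

open Filter Topology

variable {E : Type*} [NormedAddCommGroup E] [NormedSpace ℝ E] [FiniteDimensional ℝ E]
  {M : Type*} [TopologicalSpace M] [ChartedSpace E M] [IsManifold 𝓘(ℝ, E) ∞ M]
  [RiemannianBundle (fun x : M => TangentSpace 𝓘(ℝ, E) x)]
  [IsContMDiffRiemannianBundle 𝓘(ℝ, E) ∞ E (fun x : M => TangentSpace 𝓘(ℝ, E) x)]
  {E' : Type*} [NormedAddCommGroup E'] [NormedSpace ℝ E'] [FiniteDimensional ℝ E']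
  {N : Type*} [TopologicalSpace N] [ChartedSpace E' N] [IsManifold 𝓘(ℝ, E') ∞ N]
  [RiemannianBundle (fun y : N => TangentSpace 𝓘(ℝ, E') y)]
  [IsContMDiffRiemannianBundle 𝓘(ℝ, E') ∞ E' (fun y : N => TangentSpace 𝓘(ℝ, E') y)]
  {X Y Z : Π x : M, TangentSpace 𝓘(ℝ, E) x} {x : M}

theorem mvfderiv_comp_of_hasDerivAt {f : M → ℝ} {g : ℝ → ℝ} {g' : ℝ}
    (hg : HasDerivAt g g' (f x)) (hf : MDifferentiableAt 𝓘(ℝ, E) 𝓘(ℝ, ℝ) f x)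
    (v : TangentSpace 𝓘(ℝ, E) x) :
    mvfderiv 𝓘(ℝ, E) (g ∘ f) x v = g' * mvfderiv 𝓘(ℝ, E) f x v := by
  have h := (hg.hasFDerivAt.hasMFDerivAt.comp x hf.hasMFDerivAt).mfderiv
  have h' := DFunLike.congr_fun h v
  refine Eq.trans h' ?_
  exact mul_comm _ _

theorem FieldSmoothAt.inner (hX : FieldSmoothAt X x) (hY : FieldSmoothAt Y x) :
    ContMDiffAt 𝓘(ℝ, E) 𝓘(ℝ, ℝ) ∞ (fun y => inner ℝ (X y) (Y y)) x :=
  ContMDiffAt.inner_bundle (F := E) hX hY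

theorem contMDiffAt_det {ι : Type*} [Fintype ι] [DecidableEq ι] {A : M → Matrix ι ι ℝ}
    (h : ∀ i j, ContMDiffAt 𝓘(ℝ, E) 𝓘(ℝ, ℝ) ∞ (fun y => A y i j) x) :
    ContMDiffAt 𝓘(ℝ, E) 𝓘(ℝ, ℝ) ∞ (fun y => (A y).det) x := by
  simp only [Matrix.det_apply']
  exact contMDiffAt_finsetSum fun σ _ =>
    contMDiffAt_const.mul (contMDiffAt_finsetProd fun i _ => h _ _)

/-- A vector field is smooth as soon as its inner products with smooth fields are. -/
theorem fieldSmoothAt_of_inner (h : ∀ Z : Π x : M, TangentSpace 𝓘(ℝ, E) x, FieldSmoothAt Z x →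
      ContMDiffAt 𝓘(ℝ, E) 𝓘(ℝ, ℝ) ∞ (fun y => inner ℝ (X y) (Z y)) x) :
    FieldSmoothAt X x := by
  classical
  let t := trivializationAt E (TangentSpace 𝓘(ℝ, E) : M → Type _) x
  have hxt : x ∈ t.baseSet := FiberBundle.mem_baseSet_trivializationAt' x
  let b := Module.finBasis ℝ E
  let s := t.localFrame b
  have hs : ∀ i, FieldSmoothAt (s i) x := fun i => contMDiffAt_localFrame_of_mem ∞ t b i hxt
  -- The frame coefficients c of `X` solve G c = r, with G the Gram matrix of the frame. Cramer's
  -- rule writes them as quotients of determinants with smooth entries.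
  let G : M → Matrix _ _ ℝ := fun y => Matrix.gram ℝ (fun i => s i y)
  let r : M → _ → ℝ := fun y i => inner ℝ (X y) (s i y)
  have hG : ∀ i j, ContMDiffAt 𝓘(ℝ, E) 𝓘(ℝ, ℝ) ∞ (fun y => G y i j) x := fun i j =>
    (hs i).inner (hs j)
  have hr : ∀ i, ContMDiffAt 𝓘(ℝ, E) 𝓘(ℝ, ℝ) ∞ (fun y => r y i) x := fun i => h _ (hs i)
  have hdet : ∀ y ∈ t.baseSet, (G y).det ≠ 0 := by
    intro y hy
    have hli : LinearIndependent ℝ (fun i => s i y) := by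
      have hseq : (fun i => s i y) = ⇑(t.basisAt b hy) :=
        funext fun i => t.localFrame_apply_of_mem_baseSet b hy
      rw [hseq]
      exact (t.basisAt b hy).linearIndependent
    exact ((Matrix.posDef_gram_of_linearIndependent (𝕜 := ℝ) hli).det_pos).ne'
  refine (contMDiffAt_iff_localFrameCoeff (I := 𝓘(ℝ, E)) (k := ∞) b hxt).mpr fun i => ?_
  have hcoef : (fun y => (G y).cramer (r y) i * ((G y).det)⁻¹) =ᶠ[𝓝 x]
      LinearMap.piApply (t.localFrameCoeff 𝓘(ℝ, E) b i) X := by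
    filter_upwards [t.open_baseSet.mem_nhds hxt] with y hy
    have hX := t.eq_sum_localFrameCoeff_smul (I := 𝓘(ℝ, E)) (b := b) (s := X) hy
    set c : _ → ℝ := fun j => t.localFrameCoeff 𝓘(ℝ, E) b j y (X y) with hc
    have hGc : (G y).mulVec c = r y := by
      funext j
      simp only [r]
      conv_rhs => rw [hX]
      simp only [Matrix.mulVec, dotProduct, sum_inner, real_inner_smul_left, G, Matrix.gram_apply]
      refine Finset.sum_congr rfl fun k _ => ?_
      rw [mul_comm, real_inner_comm]
    have : (G y).cramer (r y) = (G y).det • c := by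
      rw [Matrix.cramer_eq_adjugate_mulVec, ← hGc, Matrix.mulVec_mulVec, Matrix.adjugate_mul,
        Matrix.smul_mulVec, Matrix.one_mulVec]
    rw [this, Pi.smul_apply, smul_eq_mul, mul_comm, ← mul_assoc, inv_mul_cancel₀ (hdet y hy),
      one_mul]
    rfl
  refine ContMDiffAt.congr_of_eventuallyEq ?_ hcoef.symm
  refine ContMDiffAt.mul ?_ ((contMDiffAt_det hG).inv₀ (hdet x hxt))
  simp only [Matrix.cramer_apply]
  refine contMDiffAt_det fun k l => ?_
  by_cases hl : l = i
  · subst hl; simpa using hr k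
  · simpa [Matrix.updateCol_apply, hl] using hG k l

/-- Every tangent vector is the value of a global smooth vector field. -/
theorem exists_isSmoothField_eq [T2Space M] (v : TangentSpace 𝓘(ℝ, E) x) :
    ∃ Z : Π x : M, TangentSpace 𝓘(ℝ, E) x, IsSmoothField Z ∧ Z x = v := by
  obtain ⟨u, hu, hsm⟩ := FiberBundle.exists_contMDiffOn_extend (k := ∞) 𝓘(ℝ, E) E v
  obtain ⟨u', hu'u, hu'o, hxu'⟩ := mem_nhds_iff.mp hu
  obtain ⟨f, -, hf⟩ :=
    ((SmoothBumpFunction.nhds_basis_tsupport (I := 𝓘(ℝ, E)) x).mem_iff).mp (hu'o.mem_nhds hxu')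
  refine ⟨fun y => f y • FiberBundle.extend E v y, ?_, by simp⟩
  exact ContMDiffOn.smul_section_of_tsupport f.contMDiff.contMDiffOn hu'o hf (hsm.mono hu'u)

theorem IsSmoothField.apply {R : Π x : M, TangentSpace 𝓘(ℝ, E) x →L[ℝ] TangentSpace 𝓘(ℝ, E) x}
    (hR : IsSmoothEndomorphism R) (hX : IsSmoothField X) : IsSmoothField (fun x => R x (X x)) :=
  ContMDiff.clm_bundle_apply (F₁ := E) (F₂ := E) hR hX

variable {F : M → N} {lam : M → ℝ}

theorem contMDiffAt_dmap (hF : ContMDiff 𝓘(ℝ, E) 𝓘(ℝ, E') ∞ F) (hZ : FieldSmoothAt Z x) :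
    ContMDiffAt 𝓘(ℝ, E) 𝓘(ℝ, E').tangent ∞
      (fun y => (⟨F y, dmap E E' F y (Z y)⟩ : TangentBundle 𝓘(ℝ, E') N)) x :=
  (hF.contMDiff_tangentMap (m := ∞) le_rfl).contMDiffAt.comp x hZ

variable (E E') in
/-- The adjoint of the differential. -/
noncomputable def adjointDmap (F : M → N) (x : M) :
    TangentSpace 𝓘(ℝ, E') (F x) →ₗ[ℝ] TangentSpace 𝓘(ℝ, E) x :=
  LinearMap.adjoint (dmap E E' F x).toLinearMap

theorem adjointDmap_inner_left (v : TangentSpace 𝓘(ℝ, E) x) (w : TangentSpace 𝓘(ℝ, E') (F x)) :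
    inner ℝ (adjointDmap E E' F x w) v = inner ℝ w (dmap E E' F x v) :=
  LinearMap.adjoint_inner_left _ _ _

theorem fieldSmoothAt_adjointDmap (hF : ContMDiff 𝓘(ℝ, E) 𝓘(ℝ, E') ∞ F)
    {W : Π x : M, TangentSpace 𝓘(ℝ, E') (F x)}
    (hW : ContMDiffAt 𝓘(ℝ, E) 𝓘(ℝ, E').tangent ∞
      (fun y => (⟨F y, W y⟩ : TangentBundle 𝓘(ℝ, E') N)) x) :
    FieldSmoothAt (fun y => adjointDmap E E' F y (W y)) x := by
  refine fieldSmoothAt_of_inner fun Z hZ => ?_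
  simp only [adjointDmap_inner_left]
  exact ContMDiffAt.inner_bundle (F := E') hW (contMDiffAt_dmap hF hZ)

namespace IsHorizontallyConformalSubmersion

variable (hF : IsHorizontallyConformalSubmersion E E' F lam)
include hF

theorem sq_pos (x : M) : 0 < lam x ^ 2 := pow_pos (hF.dilation_pos x) 2

theorem dmap_adjointDmap (x : M) (w : TangentSpace 𝓘(ℝ, E') (F x)) :
    dmap E E' F x (adjointDmap E E' F x w) = lam x ^ 2 • w :=
  apply_adjoint_of_conformal _ (hF.surjective_dmap x) (hF.conformal x) w

theorem starProjection_horiz (x : M) (v : TangentSpace 𝓘(ℝ, E) x) :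
    (horiz E E' F x).starProjection v = (lam x ^ 2)⁻¹ • adjointDmap E E' F x (dmap E E' F x v) :=
  starProjection_ker_orthogonal_of_conformal _ (hF.surjective_dmap x) (hF.sq_pos x).ne'
    (hF.conformal x) v

/-- Smoothness of λ follows from conformality: F_* (F_*)* = λ² gives |(F_*)* W|² = λ² |W|², so λ² is
a quotient of smooth functions where W ≠ 0. Over a zero-dimensional target no such W exists, and λ
is an arbitrary positive function. -/
theorem dilation_sq_smoothAt [Nontrivial E'] (x : M) :
    ContMDiffAt 𝓘(ℝ, E) 𝓘(ℝ, ℝ) ∞ (fun y => lam y ^ 2) x := by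
  obtain ⟨w, hw⟩ : ∃ w : TangentSpace 𝓘(ℝ, E') (F x), w ≠ 0 := exists_ne (α := E') 0
  let W : Π y : N, TangentSpace 𝓘(ℝ, E') y := FiberBundle.extend E' w
  have hW : FieldSmoothAt W (F x) := FiberBundle.contMDiffAt_extend 𝓘(ℝ, E') E' w
  have hWF : ContMDiffAt 𝓘(ℝ, E) 𝓘(ℝ, E').tangent ∞
      (fun y => (⟨F y, W (F y)⟩ : TangentBundle 𝓘(ℝ, E') N)) x :=
    ContMDiffAt.comp (g := fun z : N => (⟨z, W z⟩ : TangentBundle 𝓘(ℝ, E') N)) x hW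
      hF.smooth.contMDiffAt
  have hA := fieldSmoothAt_adjointDmap hF.smooth hWF
  have h1 : ContMDiffAt 𝓘(ℝ, E) 𝓘(ℝ, ℝ) ∞
      (fun y => inner ℝ (adjointDmap E E' F y (W (F y))) (adjointDmap E E' F y (W (F y)))) x :=
    ContMDiffAt.inner_bundle (F := E) hA hA
  have h2 : ContMDiffAt 𝓘(ℝ, E) 𝓘(ℝ, ℝ) ∞ (fun y => inner ℝ (W (F y)) (W (F y))) x :=
    ContMDiffAt.inner_bundle (F := E') hWF hWF
  have hne : inner ℝ (W (F x)) (W (F x)) ≠ 0 := by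
    simpa [W] using hw
  refine (h1.div₀ h2 hne).congr_of_eventuallyEq ?_
  filter_upwards [h2.continuousAt.eventually_ne hne] with y hy
  rw [Pi.div_apply, adjointDmap_inner_left, hF.dmap_adjointDmap, real_inner_smul_right, mul_div_assoc,
    div_self hy, mul_one]

theorem fieldSmoothAt_projH (hX : FieldSmoothAt X x) : FieldSmoothAt (projH E E' F X) x := by
  have hd := fieldSmoothAt_adjointDmap hF.smooth (contMDiffAt_dmap hF.smooth hX)
  have heq : projH E E' F X
      = fun y => (lam y ^ 2)⁻¹ • adjointDmap E E' F y (dmap E E' F y (X y)) :=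
    funext fun y => hF.starProjection_horiz y (X y)
  rw [heq]
  cases subsingleton_or_nontrivial E' with
  | inl h =>
    -- The factor λ⁻² may fail to be smooth here, but it multiplies zero and can be dropped.
    have h0 : ∀ y, (lam y ^ 2)⁻¹ • adjointDmap E E' F y (dmap E E' F y (X y))
        = adjointDmap E E' F y (dmap E E' F y (X y)) := fun y => by
      have : dmap E E' F y (X y) = 0 := Subsingleton.elim (α := E') _ _
      rw [this, map_zero, smul_zero]
    simpa only [h0] using hd
  | inr h =>
    exact ContMDiffAt.smul_section ((hF.dilation_sq_smoothAt x).inv₀ (hF.sq_pos x).ne') hd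

theorem isSmoothField_projH (hX : IsSmoothField X) : IsSmoothField (projH E E' F X) :=
  fun x => hF.fieldSmoothAt_projH (hX x)

theorem isSmoothField_projV (hX : IsSmoothField X) : IsSmoothField (projV E E' F X) := by
  have heq : projV E E' F X = X - projH E E' F X := by
    funext x
    have h := Submodule.starProjection_orthogonal_val (K := vert E E' F x) (X x)
    exact (sub_eq_of_eq_add' (sub_eq_iff_eq_add.mp h.symm)).symm
  rw [heq]
  exact ContMDiff.sub_section hX (hF.isSmoothField_projH hX)

theorem mdifferentiableAt_log_dilation [Nontrivial E'] (x : M) :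
    MDifferentiableAt 𝓘(ℝ, E) 𝓘(ℝ, ℝ) (fun y => Real.log (lam y)) x := by
  have h1 := (hF.dilation_sq_smoothAt x).mdifferentiableAt (by simp)
  have h2 : DifferentiableAt ℝ (fun t : ℝ => 1 / 2 * Real.log t) (lam x ^ 2) :=
    (Real.differentiableAt_log (hF.sq_pos x).ne').const_mul _
  have h3 := MDifferentiableAt.comp x h2.mdifferentiableAt h1
  refine h3.congr_of_eventuallyEq (Eventually.of_forall fun y => ?_)
  simp [Real.log_pow]

/-- Comes from λ⁻² = exp(-2 ln λ). All the ln λ terms of the second fundamental form originate in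
this derivative. -/
theorem mvfderiv_inv_dilation_sq [Nontrivial E'] (x : M) (v : TangentSpace 𝓘(ℝ, E) x) :
    mvfderiv 𝓘(ℝ, E) (fun y => (lam y ^ 2)⁻¹) x v
      = -2 * (lam x ^ 2)⁻¹ * mvfderiv 𝓘(ℝ, E) (fun y => Real.log (lam y)) x v := by
  have h : (fun y => (lam y ^ 2)⁻¹)
      = (fun t : ℝ => Real.exp (-2 * t)) ∘ fun y => Real.log (lam y) := by
    funext y
    have : -2 * Real.log (lam y) = -Real.log (lam y ^ 2) := by rw [Real.log_pow]; push_cast; ring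
    simp only [Function.comp_apply, this, Real.exp_neg, Real.exp_log (hF.sq_pos y)]
  have hd : HasDerivAt (fun t : ℝ => Real.exp (-2 * t)) (-2 * (lam x ^ 2)⁻¹)
      (Real.log (lam x)) := by
    have := ((hasDerivAt_id (Real.log (lam x))).const_mul (-2)).exp
    have hx : Real.exp (-2 * Real.log (lam x)) = (lam x ^ 2)⁻¹ := (congrFun h x).symm
    simp only [id, mul_one, hx] at this
    rwa [mul_comm] at this
  rw [h]
  exact mvfderiv_comp_of_hasDerivAt (f := fun y => Real.log (lam y)) hd
    (hF.mdifferentiableAt_log_dilation x) v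

end IsHorizontallyConformalSubmersion

end Smoothness

/-! ### Lie brackets as commutators of derivations, and brackets of F-related fields. -/

section RelatedFields

open Filter Topology

variable {E : Type*} [NormedAddCommGroup E] [NormedSpace ℝ E] [FiniteDimensional ℝ E]
  {M : Type*} [TopologicalSpace M] [ChartedSpace E M] [IsManifold 𝓘(ℝ, E) ∞ M]
  {E' : Type*} [NormedAddCommGroup E'] [NormedSpace ℝ E'] [FiniteDimensional ℝ E']
  {N : Type*} [TopologicalSpace N] [ChartedSpace E' N] [IsManifold 𝓘(ℝ, E') ∞ N]
  {X Y Z : Π x : M, TangentSpace 𝓘(ℝ, E) x} {x : M}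

theorem minSmoothness_two_le : minSmoothness ℝ 2 ≤ (∞ : WithTop ℕ∞) := by
  simp only [minSmoothness_of_isRCLikeNormedField]
  exact ENat.LEInfty.out

theorem minSmoothness_three_le : minSmoothness ℝ 3 ≤ (∞ : WithTop ℕ∞) := by
  simp only [minSmoothness_of_isRCLikeNormedField]
  exact ENat.LEInfty.out

theorem contMDiffAt_mvfderiv_apply {f : M → ℝ} (hf : ContMDiff 𝓘(ℝ, E) 𝓘(ℝ, ℝ) ∞ f)
    (hX : FieldSmoothAt X x) :
    ContMDiffAt 𝓘(ℝ, E) 𝓘(ℝ, ℝ) ∞ (fun y => mvfderiv 𝓘(ℝ, E) f y (X y)) x := by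
  have h1 := (hf.contMDiff_tangentMap (m := ∞) le_rfl).contMDiffAt.comp x hX
  exact (contMDiff_snd_tangentBundle_modelSpace ℝ 𝓘(ℝ, ℝ)).contMDiffAt.comp x h1

theorem FieldSmoothAt.mlieBracket (hX : FieldSmoothAt X x) (hY : FieldSmoothAt Y x) :
    FieldSmoothAt (mlieBracket 𝓘(ℝ, E) X Y) x :=
  have : IsManifold 𝓘(ℝ, E) (minSmoothness ℝ 2) M := IsManifold.of_le minSmoothness_two_le
  have : IsManifold 𝓘(ℝ, E) (∞ + 1) M := ‹IsManifold 𝓘(ℝ, E) ∞ M›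
  ContMDiffAt.mlieBracket_vectorField (m := ⊤) (n := ⊤) hX hY (by simp)

theorem mlieBracket_smul_right_eventually {f : M → ℝ} (hf : ContMDiff 𝓘(ℝ, E) 𝓘(ℝ, ℝ) ∞ f)
    (hZ : FieldSmoothAt Z x) :
    mlieBracket 𝓘(ℝ, E) X (f • Z) =ᶠ[𝓝 x]
      (fun y => mvfderiv 𝓘(ℝ, E) f y (X y)) • Z + f • mlieBracket 𝓘(ℝ, E) X Z := by
  have h1 : ∀ᶠ y in 𝓝 x, ContMDiffAt 𝓘(ℝ, E) 𝓘(ℝ, E).tangent 1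
      (fun y => (⟨y, Z y⟩ : TangentBundle 𝓘(ℝ, E) M)) y :=
    (contMDiffAt_iff_contMDiffAt_nhds (by simp)).mp (ContMDiffAt.of_le hZ ENat.LEInfty.out)
  filter_upwards [h1] with y hy
  exact mlieBracket_smul_right (hf.mdifferentiableAt (by simp)) (hy.mdifferentiableAt (by simp))

/-- The Lie bracket acts on functions as the commutator of derivations. -/
theorem mvfderiv_mlieBracket {f : M → ℝ} (hf : ContMDiff 𝓘(ℝ, E) 𝓘(ℝ, ℝ) ∞ f)
    (hX : FieldSmoothAt X x) (hY : FieldSmoothAt Y x) :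
    mvfderiv 𝓘(ℝ, E) f x (mlieBracket 𝓘(ℝ, E) X Y x)
      = mvfderiv 𝓘(ℝ, E) (fun y => mvfderiv 𝓘(ℝ, E) f y (Y y)) x (X x)
        - mvfderiv 𝓘(ℝ, E) (fun y => mvfderiv 𝓘(ℝ, E) f y (X y)) x (Y x) := by
  cases subsingleton_or_nontrivial E with
  | inl h =>
    have h0 : ∀ v : TangentSpace 𝓘(ℝ, E) x, v = 0 := fun v => Subsingleton.elim (α := E) _ _
    rw [h0 (X x), h0 (Y x), h0 (VectorField.mlieBracket 𝓘(ℝ, E) X Y x)]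
    simp
  | inr h =>
    obtain ⟨w, hw⟩ : ∃ w : TangentSpace 𝓘(ℝ, E) x, w ≠ 0 := exists_ne (α := E) 0
    set Z : Π y : M, TangentSpace 𝓘(ℝ, E) y := FiberBundle.extend E w with hZdef
    have hZx : Z x = w := FiberBundle.extend_apply_self E w
    have hZ : FieldSmoothAt Z x := FiberBundle.contMDiffAt_extend 𝓘(ℝ, E) E w
    have hfx : MDifferentiableAt 𝓘(ℝ, E) 𝓘(ℝ, ℝ) f x := hf.mdifferentiableAt (by simp)
    have hfZ : FieldSmoothAt (f • Z) x := ContMDiffAt.smul_section hf.contMDiffAt hZ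
    -- In [U, [V, fZ]] the second derivative U(V f) appears as a coefficient of `Z`. Subtracting f
    -- times the Jacobi identity for `X`, `Y`, `Z` from the one for `X`, `Y`, fZ leaves ([X, Y] f -
    -- X(Y f) + Y(X f)) Z = 0, and Z does not vanish at `x`.
    have key : ∀ U V : Π y : M, TangentSpace 𝓘(ℝ, E) y, FieldSmoothAt U x → FieldSmoothAt V x →
        VectorField.mlieBracket 𝓘(ℝ, E) U (VectorField.mlieBracket 𝓘(ℝ, E) V (f • Z)) x
          = mvfderiv 𝓘(ℝ, E) (fun y => mvfderiv 𝓘(ℝ, E) f y (V y)) x (U x) • Z x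
            + mvfderiv 𝓘(ℝ, E) f x (V x) • VectorField.mlieBracket 𝓘(ℝ, E) U Z x
            + (mvfderiv 𝓘(ℝ, E) f x (U x) • VectorField.mlieBracket 𝓘(ℝ, E) V Z x
              + f x • VectorField.mlieBracket 𝓘(ℝ, E) U
                  (VectorField.mlieBracket 𝓘(ℝ, E) V Z) x) := by
      intro U V hU hV
      have hVf := (contMDiffAt_mvfderiv_apply hf hV).mdifferentiableAt (by simp)
      have hVZ := (hV.mlieBracket hZ).mdiffAt
      rw [(EventuallyEq.refl _ U).mlieBracket_vectorField_eq
          (mlieBracket_smul_right_eventually hf hZ),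
        mlieBracket_add_right (hVf.smul_section hZ.mdiffAt) (hfx.smul_section hVZ),
        mlieBracket_smul_right hVf hZ.mdiffAt, mlieBracket_smul_right hfx hVZ]
    have : IsManifold 𝓘(ℝ, E) (minSmoothness ℝ 3) M := IsManifold.of_le minSmoothness_three_le
    have j1 := leibniz_identity_mlieBracket_apply (I := 𝓘(ℝ, E)) (hX.of_le minSmoothness_two_le)
      (hY.of_le minSmoothness_two_le) (hfZ.of_le minSmoothness_two_le)
    have j2 := leibniz_identity_mlieBracket_apply (I := 𝓘(ℝ, E)) (hX.of_le minSmoothness_two_le)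
      (hY.of_le minSmoothness_two_le) (hZ.of_le minSmoothness_two_le)
    rw [key X Y hX hY, key Y X hY hX, mlieBracket_smul_right hfx hZ.mdiffAt, j2] at j1
    have hz : (mvfderiv 𝓘(ℝ, E) f x (VectorField.mlieBracket 𝓘(ℝ, E) X Y x)
      - (mvfderiv 𝓘(ℝ, E) (fun y => mvfderiv 𝓘(ℝ, E) f y (Y y)) x (X x)
        - mvfderiv 𝓘(ℝ, E) (fun y => mvfderiv 𝓘(ℝ, E) f y (X y)) x (Y x))) • Z x = 0 := by
      rw [← sub_eq_zero] at j1
      rw [← neg_eq_zero, ← j1]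
      module
    rw [hZx] at hz
    exact sub_eq_zero.mp ((smul_eq_zero.mp hz).resolve_right hw)

/-- Tangent vectors are separated by smooth functions. -/
theorem eq_of_mvfderiv_eq [T2Space M] {v w : TangentSpace 𝓘(ℝ, E) x}
    (h : ∀ f : M → ℝ, ContMDiff 𝓘(ℝ, E) 𝓘(ℝ, ℝ) ∞ f →
      mvfderiv 𝓘(ℝ, E) f x v = mvfderiv 𝓘(ℝ, E) f x w) : v = w := by
  obtain ⟨ψ⟩ : Nonempty (SmoothBumpFunction 𝓘(ℝ, E) x) := inferInstance
  let φ : M → E := extChartAt 𝓘(ℝ, E) x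
  have hφ : MDifferentiableAt 𝓘(ℝ, E) 𝓘(ℝ, E) φ x :=
    (contMDiffAt_extChartAt (n := 1)).mdifferentiableAt (by simp)
  have hinv := isInvertible_mfderiv_extChartAt (I := 𝓘(ℝ, E))
    (mem_extChartAt_source (I := 𝓘(ℝ, E)) x)
  refine hinv.injective ?_
  refine (SeparatingDual.eq_iff_forall_dual_eq (R := ℝ) (V := E)).mpr fun l => ?_
  -- The bump function turns a linear coordinate of the chart into a global smooth function with the
  -- same germ at `x`.
  have hsm : ContMDiff 𝓘(ℝ, E) 𝓘(ℝ, ℝ) ∞ (fun y => l (ψ y • φ y)) :=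
    l.contMDiff.comp (ψ.contMDiff_smul contMDiffOn_extChartAt)
  have heq : (fun y => l (ψ y • φ y)) =ᶠ[𝓝 x] l ∘ φ := by
    filter_upwards [ψ.eventuallyEq_one] with y hy
    simp [hy]
  have := h _ hsm
  rw [mvfderiv_congr heq] at this
  have hcomp := mfderiv_comp x (l.differentiableAt.mdifferentiableAt) hφ
  have hval : ∀ u : TangentSpace 𝓘(ℝ, E) x, mvfderiv 𝓘(ℝ, E) (l ∘ φ) x u
      = l (mfderiv 𝓘(ℝ, E) 𝓘(ℝ, E) φ x u) := by
    intro u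
    have h1 := DFunLike.congr_fun hcomp u
    refine Eq.trans h1 ?_
    have h2 : mfderiv 𝓘(ℝ, E) 𝓘(ℝ, ℝ) l (φ x) = l := by
      rw [mfderiv_eq_fderiv]; exact l.fderiv
    exact DFunLike.congr_fun h2 _
  rw [hval, hval] at this
  exact this

/-- Brackets of related vector fields are related. -/
theorem dmap_mlieBracket [T2Space N] {F : M → N} (hF : ContMDiff 𝓘(ℝ, E) 𝓘(ℝ, E') ∞ F)
    {X' Y' : Π y : N, TangentSpace 𝓘(ℝ, E') y}
    (hX : FieldSmoothAt X x) (hY : FieldSmoothAt Y x)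
    (hX' : FieldSmoothAt X' (F x)) (hY' : FieldSmoothAt Y' (F x))
    (hXX' : ∀ y, dmap E E' F y (X y) = X' (F y)) (hYY' : ∀ y, dmap E E' F y (Y y) = Y' (F y)) :
    dmap E E' F x (mlieBracket 𝓘(ℝ, E) X Y x) = mlieBracket 𝓘(ℝ, E') X' Y' (F x) := by
  -- Relatedness means X(g ∘ F) = (X' g) ∘ F for every function g, and this passes to commutators of
  -- derivations.
  refine eq_of_mvfderiv_eq fun g hg => ?_
  have hchain : ∀ {g : N → ℝ} {y : M}, MDifferentiableAt 𝓘(ℝ, E') 𝓘(ℝ, ℝ) g (F y) →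
      ∀ v, mvfderiv 𝓘(ℝ, E) (fun z => g (F z)) y v = mvfderiv 𝓘(ℝ, E') g (F y) (dmap E E' F y v) :=
    fun {g y} hg v => mvfderiv_comp_apply y hg (hF.mdifferentiableAt (by simp)) v
  have hgd : ∀ y, MDifferentiableAt 𝓘(ℝ, E') 𝓘(ℝ, ℝ) g y := fun y => hg.mdifferentiableAt (by simp)
  have hder : ∀ {U : Π y : M, TangentSpace 𝓘(ℝ, E) y} {U' : Π y : N, TangentSpace 𝓘(ℝ, E') y}
      (_ : FieldSmoothAt U' (F x)) (_ : ∀ y, dmap E E' F y (U y) = U' (F y)) (v),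
      mvfderiv 𝓘(ℝ, E) (fun y => mvfderiv 𝓘(ℝ, E) (fun z => g (F z)) y (U y)) x v
        = mvfderiv 𝓘(ℝ, E') (fun z => mvfderiv 𝓘(ℝ, E') g z (U' z)) (F x)
            (dmap E E' F x v) := by
    intro U U' hU' hUU' v
    have : (fun y => mvfderiv 𝓘(ℝ, E) (fun z => g (F z)) y (U y))
        = fun y => (fun z => mvfderiv 𝓘(ℝ, E') g z (U' z)) (F y) := by
      funext y
      rw [hchain (hgd _), hUU']
    rw [this]
    exact hchain ((contMDiffAt_mvfderiv_apply hg hU').mdifferentiableAt (by simp)) v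
  rw [← hchain (hgd _), mvfderiv_mlieBracket (f := fun z => g (F z)) (hg.comp hF) hX hY, mvfderiv_mlieBracket hg hX' hY',
    ← hXX', ← hYY', ← hder hY' hYY', ← hder hX' hXX']

end RelatedFields

/-! ### Horizontal lifts and the second fundamental form of a horizontally conformal submersion. -/

section ConformalConnection

open Filter Topology

variable {E : Type*} [NormedAddCommGroup E] [NormedSpace ℝ E] [FiniteDimensional ℝ E]
  {M : Type*} [TopologicalSpace M] [ChartedSpace E M] [IsManifold 𝓘(ℝ, E) ∞ M]
  [RiemannianBundle (fun x : M => TangentSpace 𝓘(ℝ, E) x)]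
  [IsContMDiffRiemannianBundle 𝓘(ℝ, E) ∞ E (fun x : M => TangentSpace 𝓘(ℝ, E) x)]
  {E' : Type*} [NormedAddCommGroup E'] [NormedSpace ℝ E'] [FiniteDimensional ℝ E']
  {N : Type*} [TopologicalSpace N] [ChartedSpace E' N] [IsManifold 𝓘(ℝ, E') ∞ N]
  [RiemannianBundle (fun y : N => TangentSpace 𝓘(ℝ, E') y)]
  [IsContMDiffRiemannianBundle 𝓘(ℝ, E') ∞ E' (fun y : N => TangentSpace 𝓘(ℝ, E') y)]
  {F : M → N} {lam : M → ℝ} {x : M}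

variable (E E') in
/-- The horizontal lift of a vector field on the target of a horizontally conformal submersion. -/
noncomputable def horizontalLift (F : M → N) (lam : M → ℝ) (W : Π y : N, TangentSpace 𝓘(ℝ, E') y)
    (x : M) : TangentSpace 𝓘(ℝ, E) x :=
  (lam x ^ 2)⁻¹ • adjointDmap E E' F x (W (F x))

theorem inner_horizontalLift (W : Π y : N, TangentSpace 𝓘(ℝ, E') y) (v : TangentSpace 𝓘(ℝ, E) x) :
    inner ℝ (horizontalLift E E' F lam W x) v
      = (lam x ^ 2)⁻¹ * inner ℝ (W (F x)) (dmap E E' F x v) := by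
  rw [horizontalLift, real_inner_smul_left, adjointDmap_inner_left]

namespace IsHorizontallyConformalSubmersion

variable (hF : IsHorizontallyConformalSubmersion E E' F lam)
include hF

theorem dmap_horizontalLift (W : Π y : N, TangentSpace 𝓘(ℝ, E') y) (x : M) :
    dmap E E' F x (horizontalLift E E' F lam W x) = W (F x) := by
  rw [horizontalLift, map_smul, hF.dmap_adjointDmap, smul_smul, inv_mul_cancel₀ (hF.sq_pos x).ne',
    one_smul]

theorem inv_smul_adjointDmap_dmap {v : TangentSpace 𝓘(ℝ, E) x} (hv : v ∈ horiz E E' F x) :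
    (lam x ^ 2)⁻¹ • adjointDmap E E' F x (dmap E E' F x v) = v := by
  rw [← hF.starProjection_horiz]
  exact Submodule.starProjection_eq_self_iff.mpr hv

theorem fieldSmoothAt_horizontalLift [Nontrivial E'] {W : Π y : N, TangentSpace 𝓘(ℝ, E') y}
    (hW : FieldSmoothAt W (F x)) : FieldSmoothAt (horizontalLift E E' F lam W) x := by
  have hWF : ContMDiffAt 𝓘(ℝ, E) 𝓘(ℝ, E').tangent ∞
      (fun y => (⟨F y, W (F y)⟩ : TangentBundle 𝓘(ℝ, E') N)) x :=
    ContMDiffAt.comp (g := fun z : N => (⟨z, W z⟩ : TangentBundle 𝓘(ℝ, E') N)) x hW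
      hF.smooth.contMDiffAt
  exact ContMDiffAt.smul_section ((hF.dilation_sq_smoothAt x).inv₀ (hF.sq_pos x).ne')
    (fieldSmoothAt_adjointDmap hF.smooth hWF)

theorem mvfderiv_inner_horizontalLift [Nontrivial E'] {A B : Π y : N, TangentSpace 𝓘(ℝ, E') y}
    (hA : FieldSmoothAt A (F x)) (hB : FieldSmoothAt B (F x)) (v : TangentSpace 𝓘(ℝ, E) x) :
    mvfderiv 𝓘(ℝ, E) (fun y => inner ℝ (horizontalLift E E' F lam A y)
        (horizontalLift E E' F lam B y)) x v
      = (lam x ^ 2)⁻¹ * mvfderiv 𝓘(ℝ, E') (fun z => inner ℝ (A z) (B z)) (F x) (dmap E E' F x v)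
        - 2 * mvfderiv 𝓘(ℝ, E) (fun y => Real.log (lam y)) x v
          * inner ℝ (horizontalLift E E' F lam A x) (horizontalLift E E' F lam B x) := by
  have hAB : MDifferentiableAt 𝓘(ℝ, E') 𝓘(ℝ, ℝ) (fun z => inner ℝ (A z) (B z)) (F x) :=
    hA.mdiffAt.inner hB.mdiffAt
  have hFx : MDifferentiableAt 𝓘(ℝ, E) 𝓘(ℝ, E') F x := hF.smooth.mdifferentiableAt (by simp)
  have hl := ((hF.dilation_sq_smoothAt x).inv₀ (hF.sq_pos x).ne').mdifferentiableAt (by simp)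
  have hm := mvfderiv_fun_mul hl (hAB.comp x hFx)
  have hc : mvfderiv 𝓘(ℝ, E) ((fun z => inner ℝ (A z) (B z)) ∘ F) x v
      = mvfderiv 𝓘(ℝ, E') (fun z => inner ℝ (A z) (B z)) (F x) (dmap E E' F x v) :=
    mvfderiv_comp_apply x hAB hFx v
  simp only [inner_horizontalLift, hF.dmap_horizontalLift]
  have hm' := DFunLike.congr_fun hm v
  refine Eq.trans hm' ?_
  have hi : mvfderiv 𝓘(ℝ, E) (fun y => (lam y ^ 2)⁻¹) x v = _ := hF.mvfderiv_inv_dilation_sq x v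
  simp only [add_apply, smul_apply, smul_eq_mul, hc,
    Function.comp_apply]
  rw [hi]
  ring

/-- The Koszul expressions of vector fields and of their horizontal lifts. -/
theorem koszul_horizontalLift [Nontrivial E'] [T2Space N] {A B C : Π y : N, TangentSpace 𝓘(ℝ, E') y}
    (hA : FieldSmoothAt A (F x)) (hB : FieldSmoothAt B (F x)) (hC : FieldSmoothAt C (F x)) :
    let L := fun W => horizontalLift E E' F lam W
    let dln := mvfderiv 𝓘(ℝ, E) (fun y => Real.log (lam y)) x
    koszul (L A) (L B) (L C) x
      = (lam x ^ 2)⁻¹ * koszul A B C (F x) - 2 * dln (L A x) * inner ℝ (L B x) (L C x)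
        - 2 * dln (L B x) * inner ℝ (L A x) (L C x) + 2 * dln (L C x) * inner ℝ (L A x) (L B x) := by
  intro L dln
  -- Pairing with a lift sees only the image under F_*, and the bracket of lifts is related to the
  -- bracket on N. So the bracket terms contribute no derivative of λ.
  have hbr : ∀ {U V W : Π y : N, TangentSpace 𝓘(ℝ, E') y}, FieldSmoothAt U (F x) →
      FieldSmoothAt V (F x) → inner ℝ (mlieBracket 𝓘(ℝ, E) (L U) (L V) x) (L W x)
        = (lam x ^ 2)⁻¹ * inner ℝ (mlieBracket 𝓘(ℝ, E') U V (F x)) (W (F x)) := by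
    intro U V W hU hV
    rw [real_inner_comm, inner_horizontalLift,
      dmap_mlieBracket hF.smooth (hF.fieldSmoothAt_horizontalLift hU)
        (hF.fieldSmoothAt_horizontalLift hV) hU hV (hF.dmap_horizontalLift U)
        (hF.dmap_horizontalLift V), real_inner_comm]
  simp only [koszul]
  rw [hbr hA hB, hbr hA hC, hbr hB hC]
  simp only [L]
  rw [hF.mvfderiv_inner_horizontalLift hB hC, hF.mvfderiv_inner_horizontalLift hA hC,
    hF.mvfderiv_inner_horizontalLift hA hB]
  simp only [hF.dmap_horizontalLift]
  ring

/-- The second fundamental form of a horizontally conformal submersion on horizontal vectors. -/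
theorem inner_pullbackConnection_dmap [T2Space N] {Y : Π x : M, TangentSpace 𝓘(ℝ, E) x}
    (hY : FieldSmoothAt Y x) (hYh : ∀ y, Y y ∈ horiz E E' F y) {v z : TangentSpace 𝓘(ℝ, E) x}
    (hv : v ∈ horiz E E' F x) (hz : z ∈ horiz E E' F x) :
    let dln := mvfderiv 𝓘(ℝ, E) (fun y => Real.log (lam y)) x
    (lam x ^ 2)⁻¹ * inner ℝ (pullbackConnection E E' F (fun y => dmap E E' F y (Y y)) x v)
        (dmap E E' F x z)
      = inner ℝ (leviCivita Y x v) z + dln v * inner ℝ (Y x) z + dln (Y x) * inner ℝ v z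
        - dln z * inner ℝ v (Y x) := by
  intro dln
  cases subsingleton_or_nontrivial E' with
  | inl h =>
    -- Over a zero-dimensional target ln λ need not be differentiable, but there every horizontal
    -- vector is zero.
    have h0 : dmap E E' F x z = 0 := Subsingleton.elim (α := E') _ _
    have hz0 : z = 0 := by rw [← hF.inv_smul_adjointDmap_dmap hz, h0, map_zero, smul_zero]
    rw [h0, hz0]
    simp
  | inr h =>
    let t := trivializationAt E' (TangentSpace 𝓘(ℝ, E') : N → Type _) (F x)
    have hxt : F x ∈ t.baseSet := FiberBundle.mem_baseSet_trivializationAt' (F x)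
    let b := Module.finBasis ℝ E'
    let e : _ → TangentSpace 𝓘(ℝ, E') (F x) := fun i => t.symm (F x) (b i)
    let S : _ → Π y : N, TangentSpace 𝓘(ℝ, E') y := fun i => FiberBundle.extend E' (e i)
    -- `FiberBundle.extend` keeps the coordinates in `t` constant, so `S` is the coordinate frame
    -- used by `pullbackConnection`.
    have hSdef : ∀ i y, S i y = t.symm y (b i) := fun i y => by
      simp only [S, e, FiberBundle.extend]
      congr 1
      exact congrArg Prod.snd (t.apply_mk_symm hxt (b i))
    have hS : ∀ i, FieldSmoothAt (S i) (F x) := fun i =>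
      FiberBundle.contMDiffAt_extend 𝓘(ℝ, E') E' (e i)
    have hext : ∀ w : TangentSpace 𝓘(ℝ, E') (F x), FieldSmoothAt (FiberBundle.extend E' w) (F x) :=
      fun w => FiberBundle.contMDiffAt_extend 𝓘(ℝ, E') E' w
    have hsymm : ∀ y ∈ t.baseSet, ∀ w, t.symm y w
        = (∑ i, (b.repr w i • S i y : TangentSpace 𝓘(ℝ, E') y) : TangentSpace 𝓘(ℝ, E') y) := by
      intro y hy w
      simp only [hSdef, ← t.symmL_apply (R := ℝ) hy, ← map_smul, ← map_sum, b.sum_repr]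
    let c : M → E' := fun y => (t (⟨F y, dmap E E' F y (Y y)⟩ : TangentBundle 𝓘(ℝ, E') N)).2
    have hc : MDifferentiableAt 𝓘(ℝ, E) 𝓘(ℝ, E') c x :=
      (contMDiffAt_totalSpace.mp (contMDiffAt_dmap hF.smooth hY)).2.mdifferentiableAt
        (by simp)
    let f : _ → M → ℝ := fun i y => b.repr (c y) i
    let ρ : _ → E' →L[ℝ] ℝ := fun i => LinearMap.toContinuousLinearMap (b.coord i)
    have hf : ∀ i, MDifferentiableAt 𝓘(ℝ, E) 𝓘(ℝ, ℝ) (f i) x := fun i =>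
      (ρ i).differentiableAt.mdifferentiableAt.comp x hc
    have hdf : ∀ i, mvfderiv 𝓘(ℝ, E) (f i) x v = b.repr (mvfderiv 𝓘(ℝ, E) c x v) i := by
      intro i
      have h1 := mvfderiv_comp_apply x (ρ i).differentiableAt.mdifferentiableAt hc v
      refine Eq.trans h1 ?_
      have h2 : mfderiv 𝓘(ℝ, E') 𝓘(ℝ, ℝ) (ρ i) (c x) = ρ i := by
        rw [mfderiv_eq_fderiv]; exact (ρ i).fderiv
      exact DFunLike.congr_fun h2 _
    -- A horizontal field is determined by its image under F_*, hence is locally a combination of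
    -- lifts of the frame. The coefficients are functions on M, so `Y` itself need not be
    -- projectable.
    have hYsum : Y =ᶠ[𝓝 x] fun y =>
        (∑ i, (f i y • horizontalLift E E' F lam (S i) y : TangentSpace 𝓘(ℝ, E) y) :
          TangentSpace 𝓘(ℝ, E) y) := by
      filter_upwards [hF.smooth.continuous.continuousAt.preimage_mem_nhds
        (t.open_baseSet.mem_nhds hxt)] with y hy
      have h1 : dmap E E' F y (Y y) = ∑ i, f i y • S i (F y) := by
        rw [← hsymm _ hy]
        exact (t.symm_apply_apply_mk hy _).symm
      conv_lhs => rw [← hF.inv_smul_adjointDmap_dmap (hYh y), h1]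
      simp only [horizontalLift, map_sum, map_smul, Finset.smul_sum]
      exact Finset.sum_congr rfl fun i _ => by
        rw [smul_smul, smul_smul, mul_comm]
    let X' : Π y : N, TangentSpace 𝓘(ℝ, E') y := FiberBundle.extend E' (dmap E E' F x v)
    let Z' : Π y : N, TangentSpace 𝓘(ℝ, E') y := FiberBundle.extend E' (dmap E E' F x z)
    have hX'x : X' (F x) = dmap E E' F x v := FiberBundle.extend_apply_self E' _
    have hZ'x : Z' (F x) = dmap E E' F x z := FiberBundle.extend_apply_self E' _
    have hlX : horizontalLift E E' F lam X' x = v := by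
      rw [horizontalLift, hX'x, hF.inv_smul_adjointDmap_dmap hv]
    have hlZ : horizontalLift E E' F lam Z' x = z := by
      rw [horizontalLift, hZ'x, hF.inv_smul_adjointDmap_dmap hz]
    have hX' : FieldSmoothAt X' (F x) := hext _
    have hZ' : FieldSmoothAt Z' (F x) := hext _
    have hLS : ∀ {W : Π y : N, TangentSpace 𝓘(ℝ, E') y}, FieldSmoothAt W (F x) →
        FieldMDiffAt (horizontalLift E E' F lam W) x :=
      fun hW => (hF.fieldSmoothAt_horizontalLift hW).mdiffAt
    have hYx : Y x = ∑ i, f i x • horizontalLift E E' F lam (S i) x := hYsum.self_of_nhds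
    have hM := inner_leviCivita (hLS hX') hY.mdiffAt (hLS hZ')
    rw [koszul_congr hYsum, koszul_sum_smul_middle _ hf (fun i => hLS (hS i)) (hLS hX') (hLS hZ'),
      hlX, hlZ] at hM
    have hN := inner_leviCivita hX'.mdiffAt (hext (dmap E E' F x (Y x))).mdiffAt hZ'.mdiffAt
    -- On N the same coefficients are frozen at `x`, so their derivatives vanish (`h0`). The
    -- derivatives of `f i` that occur on M are matched by the first sum in `hpull`.
    have hextsum : (FiberBundle.extend E' (dmap E E' F x (Y x)) : Π y : N, TangentSpace 𝓘(ℝ, E') y)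
        =ᶠ[𝓝 (F x)] fun y => (∑ i, ((fun _ : N => f i x) y • S i y : TangentSpace 𝓘(ℝ, E') y) :
          TangentSpace 𝓘(ℝ, E') y) := by
      filter_upwards [t.open_baseSet.mem_nhds hxt] with y hy using hsymm y hy _
    rw [koszul_congr hextsum, koszul_sum_smul_middle _ (fun i => mdifferentiableAt_const)
      (fun i => (hS i).mdiffAt) hX'.mdiffAt hZ'.mdiffAt, hX'x, hZ'x] at hN
    have hk := fun i => hF.koszul_horizontalLift hX' (hS i) hZ'
    simp only [hlX, hlZ] at hk
    have hpull : pullbackConnection E E' F (fun y => dmap E E' F y (Y y)) x v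
        = (∑ i, mvfderiv 𝓘(ℝ, E) (f i) x v • S i (F x))
          + leviCivita (FiberBundle.extend E' (dmap E E' F x (Y x))) (F x) (dmap E E' F x v) := by
      simp only [hdf]
      rw [← hsymm _ hxt, ← t.symmL_apply (R := ℝ) hxt]
      rfl
    have h0 : ∀ i, mvfderiv 𝓘(ℝ, E') (fun _ : N => f i x) (F x) = 0 := fun i => mvfderiv_const _
    rw [hpull, inner_add_left, hN, hM, hYx]
    simp only [hk, h0, sum_inner, inner_sum, real_inner_smul_left, real_inner_smul_right, map_sum,
      map_smul, inner_horizontalLift, smul_eq_mul, Finset.mul_sum, Finset.sum_mul, mul_add,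
      ← Finset.sum_add_distrib, ← Finset.sum_sub_distrib]
    refine Finset.sum_congr rfl fun i _ => ?_
    simp
    ring

end IsHorizontallyConformalSubmersion

end ConformalConnection

/-! ### The slant identity and totally geodesic horizontal distributions. -/

section Slant

variable {E : Type*} [NormedAddCommGroup E] [NormedSpace ℝ E] [FiniteDimensional ℝ E]
  {M : Type*} [TopologicalSpace M] [ChartedSpace E M] [IsManifold 𝓘(ℝ, E) ∞ M]
  [RiemannianBundle (fun x : M => TangentSpace 𝓘(ℝ, E) x)]
  [IsContMDiffRiemannianBundle 𝓘(ℝ, E) ∞ E (fun x : M => TangentSpace 𝓘(ℝ, E) x)]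
  {E' : Type*} [NormedAddCommGroup E'] [NormedSpace ℝ E'] [FiniteDimensional ℝ E']
  {N : Type*} [TopologicalSpace N] [ChartedSpace E' N] [IsManifold 𝓘(ℝ, E') ∞ N]
  [RiemannianBundle (fun y : N => TangentSpace 𝓘(ℝ, E') y)]
  [IsContMDiffRiemannianBundle 𝓘(ℝ, E') ∞ E' (fun y : N => TangentSpace 𝓘(ℝ, E') y)]
  {F : M → N} {lam : M → ℝ} {θ : ℝ}
  {R : Π x : M, TangentSpace 𝓘(ℝ, E) x →L[ℝ] TangentSpace 𝓘(ℝ, E) x}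
  {X Y V : Π x : M, TangentSpace 𝓘(ℝ, E) x} {x : M}

theorem inner_gradient (f : M → ℝ) (v : TangentSpace 𝓘(ℝ, E) x) :
    inner ℝ (gradient f x) v = mvfderiv 𝓘(ℝ, E) f x v :=
  InnerProductSpace.toDual_symm_apply

theorem projV_add_projH (Z : Π x : M, TangentSpace 𝓘(ℝ, E) x) :
    projV E E' F Z + projH E E' F Z = Z :=
  funext fun x =>
    Submodule.starProjection_add_starProjection_orthogonal (K := vert E E' F x) (Z x)

theorem projV_mem (Z : Π x : M, TangentSpace 𝓘(ℝ, E) x) (x : M) :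
    projV E E' F Z x ∈ vert E E' F x :=
  Submodule.starProjection_apply_mem _ _

theorem projH_mem (Z : Π x : M, TangentSpace 𝓘(ℝ, E) x) (x : M) :
    projH E E' F Z x ∈ horiz E E' F x :=
  Submodule.starProjection_apply_mem _ _

theorem projV_of_mem (h : ∀ x, X x ∈ vert E E' F x) : projV E E' F X = X :=
  funext fun x => Submodule.starProjection_eq_self_iff.mpr (h x)

theorem projH_of_mem (h : ∀ x, X x ∈ horiz E E' F x) : projH E E' F X = X :=
  funext fun x => Submodule.starProjection_eq_self_iff.mpr (h x)

theorem inner_oneillA_of_vertical {w : TangentSpace 𝓘(ℝ, E) x}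
    (hX : ∀ x, X x ∈ horiz E E' F x) (hV : ∀ x, V x ∈ vert E E' F x) (hw : w ∈ horiz E E' F x) :
    inner ℝ (oneillA E E' F X V x) w = inner ℝ (leviCivita V x (X x)) w := by
  have h1 : oneillA E E' F X V = projH E E' F (fun x => leviCivita V x (X x))
      + projV E E' F (fun x => leviCivita (projH E E' F V) x (X x)) := by
    simp only [oneillA, projH_of_mem hX, projV_of_mem hV]
  have h2 : inner ℝ (projV E E' F (fun x => leviCivita (projH E E' F V) x (X x)) x) w = 0 :=
    (Submodule.mem_orthogonal _ _).mp hw _ (projV_mem _ x)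
  have h3 := congrFun (projV_add_projH (E' := E') (F := F) (fun x => leviCivita V x (X x))) x
  have h4 : inner ℝ (projV E E' F (fun x => leviCivita V x (X x)) x) w = 0 :=
    (Submodule.mem_orthogonal _ _).mp hw _ (projV_mem _ x)
  rw [h1, Pi.add_apply, inner_add_left, h2, ← h3, Pi.add_apply, inner_add_left, h4]
  ring

/-- The defect of the identity `SlantIdentity` at a point is a multiple of the vertical component
of the covariant derivative of horizontal fields. -/
theorem slantIdentity_iff [T2Space N] (hF : IsHorizontallyConformalSubmersion E E' F lam)
    (hR : IsParallelHermitianStructure R) (hθ : IsSlantAngle E E' F R θ) :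
    SlantIdentity E E' F lam R ↔
      ∀ X Y V : Π x : M, TangentSpace 𝓘(ℝ, E) x,
        IsSmoothSection (horiz E E' F) X → IsSmoothSection (horiz E E' F) Y →
        IsSmoothSection (vert E E' F) V → ∀ x,
          (1 - Real.cos θ ^ 2) * inner ℝ (leviCivita Y x (X x)) (V x) = 0 := by
  simp only [SlantIdentity]
  refine forall_congr' fun X => forall_congr' fun Y => forall_congr' fun V =>
    forall_congr' fun hX => forall_congr' fun hY => forall_congr' fun hV => forall_congr' fun x => ?_
  have hRY : IsSmoothField (fun x => R x (Y x)) := hY.1.apply hR.smooth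
  have hB : FieldMDiffAt (opB E E' F R Y) x := FieldSmoothAt.mdiffAt (hF.isSmoothField_projV hRY x)
  have hCs : FieldSmoothAt (opC E E' F R Y) x := hF.isSmoothField_projH hRY x
  have hC : FieldMDiffAt (opC E E' F R Y) x := hCs.mdiffAt
  have hCh : ∀ y, opC E E' F R Y y ∈ horiz E E' F y := projH_mem _
  have hω : omega E E' F R V x ∈ horiz E E' F x := projH_mem _ x
  have hω' : omega E E' F R (phi E E' F R V) x ∈ horiz E E' F x := projH_mem _ x
  have hRV : R x (V x) = phi E E' F R V x + omega E E' F R V x :=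
    (congrFun (projV_add_projH (E' := E') (F := F) (fun x => R x (V x))) x).symm
  have hRφV : R x (phi E E' F R V x)
      = -(Real.cos θ ^ 2) • V x + omega E E' F R (phi E E' F R V) x := by
    have h1 := inner_compression_compression (R x) (hR.sq x) (hR.isometry x) (vert E E' F x)
      (θ := θ) (fun v hv hv0 => hθ x v hv hv0) (hV.2 x)
    rw [← h1]
    exact (congrFun (projV_add_projH (E' := E') (F := F)
      (fun x => R x (phi E E' F R V x))) x).symm
  have hRn : R x (leviCivita Y x (X x))
      = leviCivita (opB E E' F R Y) x (X x) + leviCivita (opC E E' F R Y) x (X x) := by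
    rw [← hR.parallel Y hY.1, ← leviCivita_add hB hC]
    have : opB E E' F R Y + opC E E' F R Y = fun y => R y (Y y) :=
      projV_add_projH (E' := E') (F := F) _
    rw [this]
  have hskew : inner ℝ (R x (leviCivita Y x (X x))) (phi E E' F R V x)
      = -inner ℝ (leviCivita Y x (X x)) (R x (phi E E' F R V x)) := by
    have := hR.isometry x (leviCivita Y x (X x)) (R x (phi E E' F R V x))
    rw [hR.sq, inner_neg_right] at this
    linarith
  have hiso := hR.isometry x (leviCivita Y x (X x)) (V x)
  -- Expanding g(R∇_X Y, RV) = g(∇_X Y, V) brings in cos²θ g(∇_X Y, V) through φφV, leaving only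
  -- pairings with the horizontal vectors ωV and ωφV. `c1` and `c2` express these through the
  -- pullback connection, except for the B part, which is O'Neill's tensor.
  rw [hRV, inner_add_right, hskew, hRφV, hRn, inner_add_left, inner_add_right,
    real_inner_smul_right] at hiso
  have c1 := hF.inner_pullbackConnection_dmap (hY.1 x) hY.2 (hX.2 x) hω'
  have c2 := hF.inner_pullbackConnection_dmap hCs hCh (hX.2 x) hω
  simp only at c1 c2
  have hA : inner ℝ (oneillA E E' F X (opB E E' F R Y) x) (omega E E' F R V x)
      = inner ℝ (leviCivita (opB E E' F R Y) x (X x)) (omega E E' F R V x) :=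
    inner_oneillA_of_vertical hX.2 (projV_mem _) hω
  rw [c1, c2, hA]
  simp only [inner_add_left, inner_sub_left, real_inner_smul_left, inner_gradient]
  constructor <;> intro h <;> linarith

/-- Involutivity is automatic from [X, Y] = ∇_X Y - ∇_Y X. Testing on global vertical fields
suffices, since a vertical vector extends to a smooth field whose vertical projection is still
smooth and has the same value at the point. -/
theorem definesTotallyGeodesicFoliation_horiz_iff [T2Space M]
    (hF : IsHorizontallyConformalSubmersion E E' F lam) :
    DefinesTotallyGeodesicFoliation (horiz E E' F) ↔
      ∀ X Y V : Π x : M, TangentSpace 𝓘(ℝ, E) x,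
        IsSmoothSection (horiz E E' F) X → IsSmoothSection (horiz E E' F) Y →
        IsSmoothSection (vert E E' F) V → ∀ x, inner ℝ (leviCivita Y x (X x)) (V x) = 0 := by
  constructor
  · intro h X Y V hX hY hV x
    have := h.secondFundamentalForm_eq_zero X Y hX hY x
    rw [Submodule.starProjection_apply_eq_zero_iff, Submodule.orthogonal_orthogonal] at this
    rw [real_inner_comm]
    exact (Submodule.mem_orthogonal _ _).mp this _ (hV.2 x)
  · intro h
    have hmem : ∀ X Y, IsSmoothSection (horiz E E' F) X → IsSmoothSection (horiz E E' F) Y →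
        ∀ x, leviCivita Y x (X x) ∈ horiz E E' F x := by
      intro X Y hX hY x
      refine (Submodule.mem_orthogonal _ _).mpr fun v hv => ?_
      obtain ⟨Z, hZ, hZx⟩ := exists_isSmoothField_eq v
      have := h X Y (projV E E' F Z) hX hY ⟨hF.isSmoothField_projV hZ, projV_mem Z⟩ x
      have hv' : projV E E' F Z x = v := by
        rw [projV, hZx]
        exact Submodule.starProjection_eq_self_iff.mpr hv
      rw [hv', real_inner_comm] at this
      exact this
    refine ⟨fun X Y hX hY x => ?_, fun X Y hX hY x => ?_⟩
    · rw [← leviCivita_sub_leviCivita_swap (FieldSmoothAt.mdiffAt (hX.1 x))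
        (FieldSmoothAt.mdiffAt (hY.1 x))]
      exact Submodule.sub_mem _ (hmem X Y hX hY x) (hmem Y X hY hX x)
    · rw [Submodule.starProjection_apply_eq_zero_iff, Submodule.orthogonal_orthogonal]
      exact hmem X Y hX hY x

theorem slantIdentity_of_totallyGeodesic [T2Space M] [T2Space N]
    (hF : IsHorizontallyConformalSubmersion E E' F lam)
    (hR : IsParallelHermitianStructure R) (hθ : IsSlantAngle E E' F R θ)
    (h : DefinesTotallyGeodesicFoliation (horiz E E' F)) : SlantIdentity E E' F lam R := by
  rw [slantIdentity_iff hF hR hθ]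
  intro X Y V hX hY hV x
  rw [(definesTotallyGeodesicFoliation_horiz_iff hF).mp h X Y V hX hY hV x, mul_zero]

theorem totallyGeodesic_iff_slantIdentity [T2Space M] [T2Space N]
    (hF : IsHorizontallyConformalSubmersion E E' F lam)
    (hR : IsParallelHermitianStructure R) (hθ : IsSlantAngle E E' F R θ) (hθ0 : θ ≠ 0) :
    DefinesTotallyGeodesicFoliation (horiz E E' F) ↔ SlantIdentity E E' F lam R := by
  refine ⟨slantIdentity_of_totallyGeodesic hF hR hθ, fun h => ?_⟩
  rw [slantIdentity_iff hF hR hθ] at h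
  rw [definesTotallyGeodesicFoliation_horiz_iff hF]
  intro X Y V hX hY hV x
  -- The slant condition restricts θ only through nonzero vertical vectors, so cos²θ ≠ 1 is
  -- available only when V x ≠ 0.
  by_cases hVx : V x = 0
  · rw [hVx, inner_zero_right]
  have hRV : R x (V x) ≠ 0 := fun h0 => hVx (by
    have := hR.sq x (V x)
    rwa [h0, map_zero, eq_comm, neg_eq_zero] at this)
  have hcos := cos_sq_ne_one_of_angle_eq (R x (V x)) hRV (vert E E' F x)
    (hθ x (V x) (hV.2 x) hVx) hθ0
  exact (mul_eq_zero.mp (h X Y V hX hY hV x)).resolve_left (sub_ne_zero.mpr hcos.symm)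

end Slant

end SlantSubmersion

theorem theorem3p10
    {E : Type*} [NormedAddCommGroup E] [NormedSpace ℝ E] [FiniteDimensional ℝ E]
    {M : Type*} [TopologicalSpace M] [T2Space M] [SecondCountableTopology M]
    [ChartedSpace E M] [IsManifold 𝓘(ℝ, E) ∞ M]
    [RiemannianBundle (fun x : M => TangentSpace 𝓘(ℝ, E) x)]
    [IsContMDiffRiemannianBundle 𝓘(ℝ, E) ∞ E (fun x : M => TangentSpace 𝓘(ℝ, E) x)]
    {E' : Type*} [NormedAddCommGroup E'] [NormedSpace ℝ E'] [FiniteDimensional ℝ E']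
    {N : Type*} [TopologicalSpace N] [T2Space N] [SecondCountableTopology N]
    [ChartedSpace E' N] [IsManifold 𝓘(ℝ, E') ∞ N]
    [RiemannianBundle (fun y : N => TangentSpace 𝓘(ℝ, E') y)]
    [IsContMDiffRiemannianBundle 𝓘(ℝ, E') ∞ E' (fun y : N => TangentSpace 𝓘(ℝ, E') y)]
    (I J K : Π x : M, TangentSpace 𝓘(ℝ, E) x →L[ℝ] TangentSpace 𝓘(ℝ, E) x)
    (hM : IsHyperkahlerStructure I J K)
    (F : M → N) (lam : M → ℝ) (θI θJ θK : ℝ)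
    (hF : IsAlmostHConformalSlantSubmersion E E' F lam I J K θI θJ θK) :
    (DefinesTotallyGeodesicFoliation (horiz E E' F) →
      SlantIdentity E E' F lam I ∧ SlantIdentity E E' F lam J ∧ SlantIdentity E E' F lam K) ∧
    (θI ≠ 0 → (DefinesTotallyGeodesicFoliation (horiz E E' F) ↔ SlantIdentity E E' F lam I)) ∧
    (θJ ≠ 0 → (DefinesTotallyGeodesicFoliation (horiz E E' F) ↔ SlantIdentity E E' F lam J)) ∧
    (θK ≠ 0 → (DefinesTotallyGeodesicFoliation (horiz E E' F) ↔ SlantIdentity E E' F lam K)) := by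
  have hc := hF.conformalSubmersion
  exact ⟨fun h => ⟨slantIdentity_of_totallyGeodesic hc hM.kahler_I hF.slant_I h,
      slantIdentity_of_totallyGeodesic hc hM.kahler_J hF.slant_J h,
      slantIdentity_of_totallyGeodesic hc hM.kahler_K hF.slant_K h⟩,
    totallyGeodesic_iff_slantIdentity hc hM.kahler_I hF.slant_I,
    totallyGeodesic_iff_slantIdentity hc hM.kahler_J hF.slant_J,
    totallyGeodesic_iff_slantIdentity hc hM.kahler_K hF.slant_K⟩
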